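/- Let $k$ be an algebraically closed field of characteristic $0$ and let $n \ge 1$, $d \ge 1$. An endomorphism of $\mathbb{P}^n$ of degree $d$ is a map $F=(F_0:\dots:F_n)$ given by forms $F_i\in k[x_0,\dots,x_n]$ of degree $d$ without common zeros in $\mathbb{P}^n$; its critical locus $C_F$ is the vanishing locus of the Jacobian determinant $\det(\partial F_i/\partial x_j)$. The map $F$ is called *post-critically finite* if for every irreducible component $Z$ of $C_F$ there are distinct integers $s,t\ge 0$ with $F^s(Z)=F^t(Z)$, and *post-critically improper* if for every irreducible component $Z$ of $C_F$ there are integers $0\le i_0<i_1<\dots<i_n$ with $F^{i_0}(Z)\cap\dots\cap F^{i_n}(Z)\neq\varnothing$. Identify the projective space of binary forms of degree $n$ over $k$ with $\mathbb{P}^n$ by means of coefficients, and let $\eta:(\mathbb{P}^1)^n\to\mathbb{P}^n$ be the Vieta map, which sends points $P_i=(a_i:b_i)$, $i=1,\dots,n$, to the class of the form $\prod_{i=1}^n(b_ix-a_iy)$. Let $f:\mathbb{P}^1\to\mathbb{P}^1$ be a rational map of degree $d$. Then $f$ has an $n$-th symmetric power, that is, an endomorphism $F$ of $\mathbb{P}^n$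 of degree $d$ such that $$F(\eta(P_1,\dots,P_n))=\eta(f(P_1),\dots,f(P_n))\quad\text{for all }P_1,\dots,P_n\in\mathbb{P}^1,$$ and (as $\eta$ is surjective, this $F$ is unique as a map) $F$ is post-critically improper if and only if $f$ is post-critically finite. -/

import Mathlib

namespace DynImproper

open MvPolynomial

/-- The projective space `ℙⁿ` over `k` (its set of `k`-points). -/
abbrev PSpace (k : Type*) [Field k] (n : ℕ) : Type _ :=
  Projectivization k (Fin (n + 1) → k)

section

variable {k : Type*} [Field k] {n d : ℕ}

/-- Common zeros in `ℙⁿ` of a set of polynomials. It is only used for homogeneous polynomials,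
for which vanishing at a point does not depend on the representative. -/
def zeroLocus (S : Set (MvPolynomial (Fin (n + 1)) k)) : Set (PSpace k n) :=
  {P | ∀ Φ ∈ S, eval P.rep Φ = 0}

/-- Algebraic subsets of `ℙⁿ`: common zero loci of sets of homogeneous forms. -/
def IsAlgebraic (A : Set (PSpace k n)) : Prop :=
  ∃ S : Set (MvPolynomial (Fin (n + 1)) k), (∀ Φ ∈ S, ∃ m, Φ.IsHomogeneous m) ∧ A = zeroLocus S

theorem isAlgebraic_empty : IsAlgebraic (∅ : Set (PSpace k n)) := by
  refine ⟨{1}, ?_, ?_⟩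
  · rintro Φ rfl
    exact ⟨0, isHomogeneous_one _ _⟩
  · ext P
    simp [zeroLocus]

theorem isAlgebraic_sInter (A : Set (Set (PSpace k n))) (hA : ∀ a ∈ A, IsAlgebraic a) :
    IsAlgebraic (⋂₀ A) := by
  refine ⟨{Φ | (∃ m, Φ.IsHomogeneous m) ∧ ∃ a ∈ A, ∀ P ∈ a, eval P.rep Φ = 0},
    fun Φ h => h.1, ?_⟩
  ext P
  constructor
  · rintro hP Φ ⟨-, a, ha, h⟩
    exact h P (hP a ha)
  · intro hP a ha
    obtain ⟨S, hS, rfl⟩ := hA a ha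
    intro Φ hΦ
    exact hP Φ ⟨hS Φ hΦ, _, ha, fun Q hQ => hQ Φ hΦ⟩

theorem isAlgebraic_union (A : Set (PSpace k n)) (hA : IsAlgebraic A)
    (B : Set (PSpace k n)) (hB : IsAlgebraic B) : IsAlgebraic (A ∪ B) := by
  obtain ⟨S, hS, rfl⟩ := hA
  obtain ⟨T, hT, rfl⟩ := hB
  refine ⟨{Θ | ∃ Φ ∈ S, ∃ Ψ ∈ T, Θ = Φ * Ψ}, ?_, ?_⟩
  · rintro Θ ⟨Φ, hΦ, Ψ, hΨ, rfl⟩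
    obtain ⟨a, ha⟩ := hS Φ hΦ
    obtain ⟨b, hb⟩ := hT Ψ hΨ
    exact ⟨a + b, ha.mul hb⟩
  · ext P
    constructor
    · rintro (h | h) Θ ⟨Φ, hΦ, Ψ, hΨ, rfl⟩
      · simp [h Φ hΦ]
      · simp [h Ψ hΨ]
    · intro h
      by_contra hcon
      simp only [Set.mem_union, zeroLocus, Set.mem_ofPred_eq, not_or, not_forall] at hcon
      obtain ⟨⟨Φ, hΦ, h1⟩, ⟨Ψ, hΨ, h2⟩⟩ := hcon
      have h3 := h (Φ * Ψ) ⟨Φ, hΦ, Ψ, hΨ, rfl⟩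
      rw [map_mul] at h3
      exact (mul_ne_zero h1 h2) h3

/-- The Zariski topology on `ℙⁿ`, whose closed sets are the algebraic subsets. -/
@[reducible] def zariski (k : Type*) [Field k] (n : ℕ) : TopologicalSpace (PSpace k n) :=
  TopologicalSpace.ofClosed {A | IsAlgebraic A} isAlgebraic_empty
    (fun A hA => isAlgebraic_sInter A hA) (fun A hA B hB => isAlgebraic_union A hA B hB)

/-- `Z` is an irreducible component of the subset `H` of `ℙⁿ`: a maximal Zariski-irreducible
(in particular nonempty) subset of `H`. -/
def IsIrredComponent (Z H : Set (PSpace k n)) : Prop :=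
  Maximal (fun Y => @IsIrreducible _ (zariski k n) Y ∧ Y ⊆ H) Z

/-- A degree-`d` endomorphism of `ℙⁿ`, given by an affine lift: `n + 1` forms of degree `d` in
`n + 1` variables with no common zero in `ℙⁿ`. -/
structure ProjEnd (k : Type*) [Field k] (n d : ℕ) where
  /-- The coordinate forms. -/
  form : Fin (n + 1) → MvPolynomial (Fin (n + 1)) k
  homogeneous : ∀ i, (form i).IsHomogeneous d
  eq_zero_of_forall_eval : ∀ v : Fin (n + 1) → k, (∀ i, eval v (form i) = 0) → v = 0

namespace ProjEnd

theorem eval_rep_ne_zero (F : ProjEnd k n d) (P : PSpace k n) :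
    (fun i => eval P.rep (F.form i)) ≠ 0 := fun h =>
  P.rep_nonzero (F.eq_zero_of_forall_eval P.rep fun i => congrFun h i)

/-- The self-map `(x₀ : … : xₙ) ↦ (F₀(x) : … : Fₙ(x))` of `ℙⁿ`. -/
noncomputable def map (F : ProjEnd k n d) (P : PSpace k n) : PSpace k n :=
  Projectivization.mk k (fun i => eval P.rep (F.form i)) (F.eval_rep_ne_zero P)

/-- The Jacobian determinant `det (∂Fᵢ/∂xⱼ)` of the lift. -/
noncomputable def jacobian (F : ProjEnd k n d) : MvPolynomial (Fin (n + 1)) k :=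
  Matrix.det (Matrix.of fun i j => pderiv j (F.form i))

/-- The critical locus, the vanishing locus of the Jacobian determinant. -/
def criticalLocus (F : ProjEnd k n d) : Set (PSpace k n) :=
  zeroLocus {F.jacobian}

/-- `X` is preperiodic: each irreducible component `Z` of `X` has `F^s(Z) = F^t(Z)` for some
distinct `s` and `t`. -/
def IsPreperiodic (F : ProjEnd k n d) (X : Set (PSpace k n)) : Prop :=
  ∀ Z, IsIrredComponent Z X → ∃ s t : ℕ, s ≠ t ∧ F.map^[s] '' Z = F.map^[t] '' Z

/-- `H` is improper: for each irreducible component `Z` of `H` there are `i₀ < … < iₙ` such that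
`F^{i₀}(Z) ∩ … ∩ F^{iₙ}(Z)` is nonempty. -/
def IsImproper (F : ProjEnd k n d) (H : Set (PSpace k n)) : Prop :=
  ∀ Z, IsIrredComponent Z H →
    ∃ i : Fin (n + 1) → ℕ, StrictMono i ∧ (⋂ j, F.map^[i j] '' Z).Nonempty

/-- Post-critically finite: the critical locus is preperiodic. -/
def PostCriticallyFinite (F : ProjEnd k n d) : Prop :=
  F.IsPreperiodic F.criticalLocus

/-- Post-critically improper: the critical locus is improper. -/
def PostCriticallyImproper (F : ProjEnd k n d) : Prop :=
  F.IsImproper F.criticalLocus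

end ProjEnd

/-- The linear form `b x - a y` attached to the point `P = (a : b)` of `ℙ¹`. -/
noncomputable def linForm (P : PSpace k 1) : MvPolynomial (Fin 2) k :=
  C (P.rep 1) * X 0 - C (P.rep 0) * X 1

/-- The coefficients of a binary form of degree `n`: the `j`-th one is the coefficient of
`x^j y^(n-j)`. -/
noncomputable def binaryCoeffs (n : ℕ) (Φ : MvPolynomial (Fin 2) k) : Fin (n + 1) → k :=
  fun j => coeff (Finsupp.single 0 (j : ℕ) + Finsupp.single 1 (n - (j : ℕ))) Φ

theorem linForm_ne_zero (P : PSpace k 1) : linForm P ≠ 0 := by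
  intro h
  apply P.rep_nonzero
  have h0 : eval ![1, 0] (linForm P) = 0 := by rw [h, map_zero]
  have h1 : eval ![0, 1] (linForm P) = 0 := by rw [h, map_zero]
  simp [linForm] at h0 h1
  funext i
  fin_cases i
  · simpa using h1
  · simpa using h0

theorem linForm_isHomogeneous (P : PSpace k 1) : (linForm P).IsHomogeneous 1 := by
  refine IsHomogeneous.sub ?_ ?_ <;>
  simpa using (isHomogeneous_C (Fin 2) (_ : k)).mul (isHomogeneous_X k _)

theorem binaryCoeffs_prod_ne_zero (P : Fin n → PSpace k 1) :
    binaryCoeffs n (∏ i, linForm (P i)) ≠ 0 := by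
  intro h
  have hne : (∏ i, linForm (P i)) ≠ 0 := Finset.prod_ne_zero_iff.2 fun i _ => linForm_ne_zero _
  have hh : (∏ i, linForm (P i)).IsHomogeneous n := by
    simpa using IsHomogeneous.prod Finset.univ (fun i => linForm (P i)) (fun _ => 1)
      (fun i _ => linForm_isHomogeneous _)
  obtain ⟨m, hm⟩ := ne_zero_iff.1 hne
  have hdeg : m 0 + m 1 = n := by
    have := hh hm
    simpa [Finsupp.weight_apply, Finsupp.sum_fintype, Fin.sum_univ_two] using this
  apply hm
  have hm2 : (Finsupp.single 0 (m 0) + Finsupp.single 1 (n - m 0) : Fin 2 →₀ ℕ) = m := by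
    ext i
    fin_cases i
    · simp
    · simp; omega
  have h2 : coeff (Finsupp.single 0 (m 0) + Finsupp.single 1 (n - m 0)) (∏ i, linForm (P i)) = 0 :=
    congrFun h ⟨m 0, by omega⟩
  rwa [hm2] at h2

/-- The Vieta map `η : (ℙ¹)ⁿ → ℙⁿ`, sending points `Pᵢ = (aᵢ : bᵢ)` to the class of the binary
form `∏ (bᵢ x - aᵢ y)`. The projective space of binary forms of degree `n` is identified with
`ℙⁿ` through the coefficients. -/
noncomputable def vieta (P : Fin n → PSpace k 1) : PSpace k n :=
  Projectivization.mk k (binaryCoeffs n (∏ i, linForm (P i))) (binaryCoeffs_prod_ne_zero P)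

/-- `F` is the `n`-th symmetric power of `f`: the degree-`d` endomorphism of `ℙⁿ` induced by
`f × … × f` through the Vieta map. -/
def IsSymmetricPower (f : ProjEnd k 1 d) (F : ProjEnd k n d) : Prop :=
  ∀ P : Fin n → PSpace k 1, F.map (vieta P) = vieta (fun i => f.map (P i))

end

end DynImproper

/-! A point of `ℙⁿ` is a binary form up to scalar, that is, an unordered `n`-tuple of roots, and the
symmetric power `F` moves every root by `f`. To construct it, note that the value at `y` of the
image form is, up to the choice of lift, the product over the roots of the form cutting out
`f⁻¹(y)`. Such a product is a polynomial in the coefficients (`exists_isNorm`), and `n + 1` values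
determine a form of degree `n` (`exists_isSymmetricLift`).

Two facts about the critical locus of `F` suffice. It contains the hyperplane `H_c` of forms with
root `c`, for every critical point `c` of `f`, and `H_c` is a component
(`IsSymmetricLift.isIrredComponent_zeroLocus_evForm`). Conversely, a form in it has a critical root
or two roots with the same image under `f` (`IsSymmetricLift.vieta_notMem_criticalLocus`).

Improper implies finite: a form in `F^{i₀}(H_c) ∩ … ∩ F^{iₙ}(H_c)` has all the `n + 1` points
`f^{iⱼ}(c)` among its `n` roots, so two of them coincide.

Finite implies improper: fix `n - 1` distinct points `p` outside the finite postcritical set `S`.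
Pull them back by `f^{i+1}` and complete them by one root to a form in the component `Z`. As `Z` is
critical, the image of this last root under `f^{i+1}` lies in the finite set `S ∪ p`. Hence each
`F^{i+1}(Z)` meets one fixed finite set, and some point of it lies in infinitely many of these
images. -/

namespace DynImproper

open MvPolynomial

/-! ### Homogeneous polynomials: factors and the Nullstellensatz. -/

section HomogeneousForms

variable {k : Type*} [Field k] {σ : Type*}

theorem eval_smul_of_isHomogeneous [Fintype σ] {Φ : MvPolynomial σ k} {m : ℕ}
    (h : Φ.IsHomogeneous m) (s : k) (v : σ → k) : eval (s • v) Φ = s ^ m * eval v Φ := by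
  rw [eval_eq', eval_eq', Finset.mul_sum]
  refine Finset.sum_congr rfl fun u hu => ?_
  have hdeg : ∑ i, u i = m := by
    have := h (mem_support_iff.1 hu)
    simpa [Finsupp.weight_apply, Finsupp.sum_fintype] using this
  simp only [Pi.smul_apply, smul_eq_mul, mul_pow, Finset.prod_mul_distrib,
    Finset.prod_pow_eq_pow_sum, hdeg]
  ring

theorem eval_zero_of_isHomogeneous [Fintype σ] {Φ : MvPolynomial σ k} {m : ℕ}
    (h : Φ.IsHomogeneous m) (hm : m ≠ 0) : eval 0 Φ = 0 := by
  have := eval_smul_of_isHomogeneous h 0 0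
  simpa [hm] using this

/-- The substitution `Xᵢ ↦ Xᵢ t`, which records the homogeneous components as the coefficients of
a polynomial in `t`. -/
noncomputable def grading : MvPolynomial σ k →ₐ[k] Polynomial (MvPolynomial σ k) :=
  aeval fun i => Polynomial.C (X i) * Polynomial.X

theorem grading_of_isHomogeneous {Φ : MvPolynomial σ k} {m : ℕ} (h : Φ.IsHomogeneous m) :
    grading Φ = Polynomial.monomial m Φ := by
  have key : ∀ u : σ →₀ ℕ, ∀ c : k,
      grading (monomial u c) = Polynomial.monomial u.degree (monomial u c) := by
    intro u c
    rw [grading, aeval_monomial, monomial_eq (s := u), Finsupp.degree,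
      ← Polynomial.C_mul_X_pow_eq_monomial]
    simp only [Finsupp.prod, mul_pow, Finset.prod_mul_distrib, Finset.prod_pow_eq_pow_sum,
      map_mul, map_prod, map_pow]
    rw [mul_assoc]
    rfl
  rw [Φ.as_sum, map_sum, map_sum]
  refine Finset.sum_congr rfl fun u hu => ?_
  have hdeg : u.degree = m := by
    by_contra hne
    exact mem_support_iff.1 hu (h.coeff_eq_zero hne)
  rw [key, hdeg]

theorem coeff_grading (Φ : MvPolynomial σ k) (m : ℕ) :
    (grading Φ).coeff m = homogeneousComponent m Φ := by
  conv_lhs => rw [← sum_homogeneousComponent Φ]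
  rw [map_sum, Polynomial.finsetSum_coeff]
  simp only [grading_of_isHomogeneous (homogeneousComponent_isHomogeneous _ Φ),
    Polynomial.coeff_monomial]
  rw [Finset.sum_ite_eq']
  split_ifs with hm
  · rfl
  · rw [homogeneousComponent_eq_zero]
    simpa using hm

theorem eval_one_grading (Φ : MvPolynomial σ k) : (grading Φ).eval 1 = Φ := by
  have : (Polynomial.evalRingHom (1 : MvPolynomial σ k)).comp
      (grading : MvPolynomial σ k →ₐ[k] _).toRingHom = RingHom.id _ := by
    ext i <;> simp [grading]
  exact DFunLike.congr_fun this Φ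

/-- Under `grading`, both the degree and the order in `t` are additive on products. A product that
is a monomial in `t` therefore forces degree and order to agree on each factor. -/
theorem exists_isHomogeneous_of_dvd {Φ Ψ : MvPolynomial σ k} {m : ℕ} (h : Φ.IsHomogeneous m)
    (h0 : Φ ≠ 0) (hd : Ψ ∣ Φ) : ∃ a, Ψ.IsHomogeneous a := by
  obtain ⟨Θ, rfl⟩ := hd
  have hΨ : grading Ψ ≠ 0 := fun hz => h0 <| by
    rw [← eval_one_grading Ψ, hz]; simp
  have hΘ : grading Θ ≠ 0 := fun hz => h0 <| by
    rw [← eval_one_grading Θ, hz]; simp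
  have hm := grading_of_isHomogeneous h
  rw [map_mul] at hm
  have h1 : (grading Ψ).natDegree + (grading Θ).natDegree = m := by
    rw [← Polynomial.natDegree_mul hΨ hΘ, hm, Polynomial.natDegree_monomial_eq _ h0]
  have h2 : (grading Ψ).natTrailingDegree + (grading Θ).natTrailingDegree = m := by
    rw [← Polynomial.natTrailingDegree_mul hΨ hΘ, hm, Polynomial.natTrailingDegree_monomial h0]
  have h3 := (grading Ψ).natTrailingDegree_le_natDegree
  have h4 := (grading Θ).natTrailingDegree_le_natDegree
  refine ⟨(grading Ψ).natDegree, ?_⟩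
  have hc := homogeneousComponent_isHomogeneous (grading Ψ).natDegree Ψ
  suffices hs : homogeneousComponent (grading Ψ).natDegree Ψ = Ψ by rwa [hs] at hc
  rw [← coeff_grading]
  conv_rhs => rw [← eval_one_grading Ψ, Polynomial.eval_eq_sum_range]
  rw [Finset.sum_eq_single (grading Ψ).natDegree]
  · simp
  · intro b hb hb'
    rw [Polynomial.coeff_eq_zero_of_lt_natTrailingDegree, zero_mul]
    have := Finset.mem_range.1 hb
    omega
  · simp

theorem irreducible_of_isHomogeneous_one {Φ : MvPolynomial σ k} (h : Φ.IsHomogeneous 1)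
    (h0 : Φ ≠ 0) : Irreducible Φ := by
  refine irreducible_of_totalDegree_eq_one (h.totalDegree h0) fun x hx => ?_
  obtain ⟨u, hu⟩ := ne_zero_iff.1 h0
  rw [isUnit_iff_ne_zero]
  rintro rfl
  exact hu (zero_dvd_iff.1 (hx u))

/-- The Nullstellensatz puts a power of `Φ` in the ideal of `g`, and `g` is prime. -/
theorem dvd_of_forall_eval_eq_zero [IsAlgClosed k] [Finite σ] {g Φ : MvPolynomial σ k}
    (hg : Irreducible g) (h : ∀ v, eval v g = 0 → eval v Φ = 0) : g ∣ Φ := by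
  have hp : Prime g := hg.prime
  have hrad : Φ ∈ (Ideal.span {g}).radical := by
    rw [← vanishingIdeal_zeroLocus_eq_radical (K := k)]
    intro v hv
    rw [zeroLocus_span] at hv
    simpa [aeval_eq_eval] using h v (by simpa [aeval_eq_eval] using hv g rfl)
  obtain ⟨N, hN⟩ := hrad
  exact hp.dvd_of_dvd_pow (Ideal.mem_span_singleton.1 hN)

theorem isHomogeneous_of_mul_left {Φ Ψ : MvPolynomial σ k} {m a : ℕ}
    (h : (Φ * Ψ).IsHomogeneous (m + a)) (hΦ : Φ.IsHomogeneous m) (h0 : Φ * Ψ ≠ 0) :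
    Ψ.IsHomogeneous a := by
  obtain ⟨b, hb⟩ := exists_isHomogeneous_of_dvd h h0 (Dvd.intro_left Φ rfl)
  have := (hΦ.mul hb).inj_right h h0
  obtain rfl : b = a := by omega
  exact hb

/-- The pullback of the coordinates along a linear parametrization is computed by evaluation. -/
theorem eval_aeval_eq {τ : Type*} (Φ : MvPolynomial σ k) (q : σ → MvPolynomial τ k) (v : τ → k) :
    eval v (aeval q Φ) = eval (fun i => eval v (q i)) Φ := by
  have : (eval v).comp (aeval q : MvPolynomial σ k →ₐ[k] _).toRingHom =
      eval fun i => eval v (q i) := by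
    ext i <;> simp
  exact DFunLike.congr_fun this Φ

end HomogeneousForms

/-! ### Binary forms, their roots and their coefficient vectors. -/

section BinaryForms

variable {k : Type*} [Field k] {n : ℕ}

/-- The linear form `b x - a y` attached to the vector `v = (a, b)`. -/
noncomputable def lin (v : Fin 2 → k) : MvPolynomial (Fin 2) k :=
  C (v 1) * X 0 - C (v 0) * X 1

theorem eval_lin (v x : Fin 2 → k) : eval x (lin v) = v 1 * x 0 - v 0 * x 1 := by
  simp [lin]

theorem eval_lin_self (v : Fin 2 → k) : eval v (lin v) = 0 := by
  rw [eval_lin]; ring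

theorem eval_lin_swap (v x : Fin 2 → k) : eval x (lin v) = -eval v (lin x) := by
  simp only [eval_lin]; ring

theorem lin_isHomogeneous (v : Fin 2 → k) : (lin v).IsHomogeneous 1 := by
  refine IsHomogeneous.sub ?_ ?_ <;>
  simpa using (isHomogeneous_C (Fin 2) (_ : k)).mul (isHomogeneous_X k _)

theorem lin_smul (s : k) (v : Fin 2 → k) : lin (s • v) = C s * lin v := by
  simp only [lin, Pi.smul_apply, smul_eq_mul, map_mul]; ring

theorem exists_eval_lin_ne_zero {v : Fin 2 → k} (hv : v ≠ 0) :
    ∃ x : Fin 2 → k, eval x (lin v) ≠ 0 := by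
  by_contra! h
  apply hv
  have h0 := h ![1, 0]
  have h1 := h ![0, 1]
  simp only [eval_lin] at h0 h1
  funext i
  fin_cases i
  · simpa using h1
  · simpa using h0

theorem lin_ne_zero {v : Fin 2 → k} (hv : v ≠ 0) : lin v ≠ 0 := by
  obtain ⟨x, hx⟩ := exists_eval_lin_ne_zero hv
  rintro h
  simp [h] at hx

theorem lin_irreducible {v : Fin 2 → k} (hv : v ≠ 0) : Irreducible (lin v) :=
  irreducible_of_isHomogeneous_one (lin_isHomogeneous v) (lin_ne_zero hv)

theorem exists_eq_smul_of_eval_lin_eq_zero {v x : Fin 2 → k} (hv : v ≠ 0)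
    (h : eval x (lin v) = 0) : ∃ s : k, x = s • v := by
  rw [eval_lin] at h
  by_cases h0 : v 0 = 0
  · have h1 : v 1 ≠ 0 := fun h1 => hv (by funext i; fin_cases i <;> simp [h0, h1])
    refine ⟨x 1 / v 1, ?_⟩
    have hx : x 0 = 0 := by simpa [h0, h1] using h
    funext i
    fin_cases i
    · simp [h0, hx]
    · simp [h1]
  · refine ⟨x 0 / v 0, ?_⟩
    funext i
    fin_cases i
    · simp [h0]
    · simp only [Fin.mk_one, Pi.smul_apply, smul_eq_mul]
      field_simp
      linear_combination -h

theorem eval_lin_eq_zero_iff_mk_eq {v x : Fin 2 → k} (hv : v ≠ 0) (hx : x ≠ 0) :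
    eval x (lin v) = 0 ↔ (Projectivization.mk k x hx : PSpace k 1) = Projectivization.mk k v hv := by
  rw [Projectivization.mk_eq_mk_iff']
  constructor
  · intro h
    obtain ⟨s, hs⟩ := exists_eq_smul_of_eval_lin_eq_zero hv h
    exact ⟨s, hs.symm⟩
  · rintro ⟨s, rfl⟩
    rw [eval_smul_of_isHomogeneous (lin_isHomogeneous v), eval_lin_self, mul_zero]

theorem lin_dvd [IsAlgClosed k] {Φ : MvPolynomial (Fin 2) k} {m : ℕ} (h : Φ.IsHomogeneous m)
    {v : Fin 2 → k} (hv : v ≠ 0) (h0 : eval v Φ = 0) : lin v ∣ Φ := by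
  refine dvd_of_forall_eval_eq_zero (lin_irreducible hv) fun x hx => ?_
  obtain ⟨s, rfl⟩ := exists_eq_smul_of_eval_lin_eq_zero hv hx
  rw [eval_smul_of_isHomogeneous h, h0, mul_zero]

/-- Restriction of a binary form to the affine line `y = 1`. -/
noncomputable def dehomogenize : MvPolynomial (Fin 2) k →ₐ[k] Polynomial k :=
  aeval ![Polynomial.X, 1]

theorem eval_dehomogenize (Φ : MvPolynomial (Fin 2) k) (t : k) :
    (dehomogenize Φ).eval t = eval ![t, 1] Φ := by
  have : (Polynomial.evalRingHom t).comp
      (dehomogenize : MvPolynomial (Fin 2) k →ₐ[k] _).toRingHom = eval ![t, 1] := by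
    ext i
    · simp
    · fin_cases i <;> simp [dehomogenize]
  exact DFunLike.congr_fun this Φ

/-- A form that is constant on the line `y = 1` is `e y^m`, so it vanishes at infinity as soon as `m
> 0`. -/
theorem eval_infinity_eq_zero [Infinite k] {Φ : MvPolynomial (Fin 2) k} {m : ℕ}
    (h : Φ.IsHomogeneous m) (hm : m ≠ 0) {e : k} (he : ∀ t, eval ![t, 1] Φ = e) :
    eval ![1, 0] Φ = 0 := by
  set q : Polynomial k := aeval ![1, Polynomial.X] Φ
  have hqe : ∀ t, q.eval t = eval ![1, t] Φ := by
    intro t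
    have : (Polynomial.evalRingHom t).comp
        (aeval ![1, Polynomial.X] : MvPolynomial (Fin 2) k →ₐ[k] Polynomial k).toRingHom =
        eval ![1, t] := by
      ext i
      · simp
      · fin_cases i <;> simp
    exact DFunLike.congr_fun this Φ
  -- Homogeneity compares the two charts only for `t ≠ 0`; the factor `X` makes the identity hold at
  -- `t = 0` too.
  have hmul : Polynomial.X * (q - Polynomial.C e * Polynomial.X ^ m) = 0 := by
    refine Polynomial.funext fun t => ?_
    by_cases ht : t = 0
    · simp [ht]
    · have hsm : (![1, t] : Fin 2 → k) = t • ![t⁻¹, 1] := by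
        funext i
        fin_cases i <;> simp [ht]
      have : q.eval t = t ^ m * e := by rw [hqe, hsm, eval_smul_of_isHomogeneous h, he]
      simp only [Polynomial.eval_mul, Polynomial.eval_X, Polynomial.eval_sub, this,
        Polynomial.eval_C, Polynomial.eval_pow, Polynomial.eval_zero]
      ring
  have hq' : q = Polynomial.C e * Polynomial.X ^ m :=
    sub_eq_zero.1 ((mul_eq_zero.1 hmul).resolve_left Polynomial.X_ne_zero)
  rw [← hqe, hq']
  simp [hm]

theorem exists_eval_eq_zero_of_isHomogeneous [IsAlgClosed k] {Φ : MvPolynomial (Fin 2) k} {m : ℕ}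
    (h : Φ.IsHomogeneous m) (hm : m ≠ 0) : ∃ v ≠ 0, eval v Φ = 0 := by
  by_cases hc : (dehomogenize Φ).degree = 0
  · refine ⟨![1, 0], fun h0 => by simpa using congrFun h0 0, ?_⟩
    refine eval_infinity_eq_zero h hm (e := (dehomogenize Φ).coeff 0) fun t => ?_
    rw [← eval_dehomogenize]
    conv_lhs => rw [Polynomial.eq_C_of_degree_eq_zero hc]
    simp
  · obtain ⟨t, ht⟩ := IsAlgClosed.exists_root _ hc
    refine ⟨![t, 1], fun h0 => by simpa using congrFun h0 1, ?_⟩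
    rw [← eval_dehomogenize]
    exact ht

/-- Induction over nonzero binary forms along their linear factors. -/
theorem binaryForm_induction [IsAlgClosed k] {motive : ℕ → MvPolynomial (Fin 2) k → Prop}
    (const : ∀ c : k, c ≠ 0 → motive 0 (C c))
    (mul : ∀ (m : ℕ) (v : Fin 2 → k) (Φ : MvPolynomial (Fin 2) k), v ≠ 0 → Φ.IsHomogeneous m →
      motive m Φ → motive (m + 1) (lin v * Φ))
    {m : ℕ} {Φ : MvPolynomial (Fin 2) k} (h : Φ.IsHomogeneous m) (h0 : Φ ≠ 0) : motive m Φ := by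
  induction m generalizing Φ with
  | zero =>
    have := totalDegree_eq_zero_iff_eq_C.1 ((totalDegree_zero_iff_isHomogeneous _).2 h)
    rw [this]
    refine const _ fun hz => h0 ?_
    rw [this, hz, map_zero]
  | succ m ih =>
    obtain ⟨v, hv, hv0⟩ := exists_eval_eq_zero_of_isHomogeneous h m.succ_ne_zero
    obtain ⟨Ψ, rfl⟩ := lin_dvd h hv hv0
    have hΨ : Ψ.IsHomogeneous m :=
      isHomogeneous_of_mul_left (m := 1) (by rwa [add_comm 1 m]) (lin_isHomogeneous v) h0
    exact mul m v Ψ hv hΨ (ih hΨ (right_ne_zero_of_mul h0))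

theorem exists_eq_C_mul_prod_lin [IsAlgClosed k] {m : ℕ} {Φ : MvPolynomial (Fin 2) k}
    (h : Φ.IsHomogeneous m) (h0 : Φ ≠ 0) :
    ∃ c : k, c ≠ 0 ∧ ∃ v : Fin m → Fin 2 → k, (∀ i, v i ≠ 0) ∧ Φ = C c * ∏ i, lin (v i) := by
  refine binaryForm_induction (motive := fun m Φ => ∃ c : k, c ≠ 0 ∧ ∃ v : Fin m → Fin 2 → k,
    (∀ i, v i ≠ 0) ∧ Φ = C c * ∏ i, lin (v i)) ?_ ?_ h h0
  · intro c hc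
    exact ⟨c, hc, Fin.elim0, fun i => i.elim0, by simp⟩
  · rintro m v Φ hv - ⟨c, hc, u, hu, rfl⟩
    refine ⟨c, hc, Fin.cons v u, fun i => ?_, ?_⟩
    · induction i using Fin.cases with
      | zero => simpa using hv
      | succ i => simpa using hu i
    · rw [Fin.prod_univ_succ]
      simp only [Fin.cons_zero, Fin.cons_succ]
      ring

/-- The binary form of degree `n` with given coefficients. -/
noncomputable def toForm (w : Fin (n + 1) → k) : MvPolynomial (Fin 2) k :=
  ∑ j : Fin (n + 1), monomial (Finsupp.single 0 (j : ℕ) + Finsupp.single 1 (n - (j : ℕ))) (w j)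

theorem exponent_eq_iff {m : Fin 2 →₀ ℕ} (j : Fin (n + 1)) :
    (Finsupp.single 0 (j : ℕ) + Finsupp.single 1 (n - (j : ℕ)) : Fin 2 →₀ ℕ) = m ↔
      m 0 = j ∧ m 0 + m 1 = n := by
  have := j.2
  constructor
  · rintro rfl
    simp
    omega
  · rintro ⟨h1, h2⟩
    ext i
    fin_cases i
    · simp [h1]
    · simp; omega

theorem toForm_isHomogeneous (w : Fin (n + 1) → k) : (toForm w).IsHomogeneous n := by
  refine IsHomogeneous.sum _ _ _ fun j _ => isHomogeneous_monomial _ ?_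
  have := j.2
  simp [Finsupp.degree_eq_sum]
  omega

theorem binaryCoeffs_toForm (w : Fin (n + 1) → k) : binaryCoeffs n (toForm w) = w := by
  funext i
  rw [binaryCoeffs, toForm, coeff_sum, Finset.sum_eq_single i]
  · simp
  · intro j _ hj
    rw [coeff_monomial, if_neg]
    rw [exponent_eq_iff]
    rintro ⟨h, -⟩
    exact hj (Fin.ext (by simpa using h.symm))
  · simp

theorem toForm_binaryCoeffs {Φ : MvPolynomial (Fin 2) k} (h : Φ.IsHomogeneous n) :
    toForm (binaryCoeffs n Φ) = Φ := by
  ext m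
  rw [toForm, coeff_sum]
  by_cases hm : m 0 + m 1 = n
  · rw [Finset.sum_eq_single ⟨m 0, by omega⟩]
    · have := (exponent_eq_iff (n := n) (m := m) ⟨m 0, by omega⟩).2 ⟨rfl, hm⟩
      rw [coeff_monomial, if_pos this, binaryCoeffs, this]
    · intro j _ hj
      rw [coeff_monomial, if_neg]
      rw [exponent_eq_iff]
      rintro ⟨h, -⟩
      exact hj (Fin.ext h.symm)
    · simp
  · rw [h.coeff_eq_zero (by simpa [Finsupp.degree_eq_sum] using hm)]
    refine Finset.sum_eq_zero fun j _ => ?_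
    rw [coeff_monomial, if_neg]
    rw [exponent_eq_iff]
    exact fun h => hm h.2

/-- The linear form on the space of binary forms of degree `n` that evaluates them at `y`. -/
noncomputable def evForm (n : ℕ) (y : Fin 2 → k) : MvPolynomial (Fin (n + 1)) k :=
  ∑ j : Fin (n + 1), C (y 0 ^ (j : ℕ) * y 1 ^ (n - (j : ℕ))) * X j

theorem eval_evForm (w : Fin (n + 1) → k) (y : Fin 2 → k) :
    eval w (evForm n y) = ∑ j : Fin (n + 1), y 0 ^ (j : ℕ) * y 1 ^ (n - (j : ℕ)) * w j := by
  simp [evForm]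

theorem eval_evForm_eq_toForm (w : Fin (n + 1) → k) (y : Fin 2 → k) :
    eval w (evForm n y) = eval y (toForm w) := by
  rw [eval_evForm, toForm, map_sum]
  refine Finset.sum_congr rfl fun j _ => ?_
  rw [eval_monomial, Finsupp.prod_fintype _ _ (by simp)]
  simp
  ring

theorem evForm_isHomogeneous (y : Fin 2 → k) : (evForm n y).IsHomogeneous 1 :=
  IsHomogeneous.sum _ _ _ fun j _ => isHomogeneous_C_mul_X _ j

theorem exists_monomial_ne_zero {y : Fin 2 → k} (hy : y ≠ 0) :
    ∃ j : Fin (n + 1), y 0 ^ (j : ℕ) * y 1 ^ (n - (j : ℕ)) ≠ 0 := by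
  by_cases h0 : y 0 = 0
  · have h1 : y 1 ≠ 0 := fun h1 => hy (by funext i; fin_cases i <;> simp [h0, h1])
    exact ⟨0, by simp [h1]⟩
  · exact ⟨Fin.last n, by simp [h0]⟩

theorem evForm_ne_zero {y : Fin 2 → k} (hy : y ≠ 0) : evForm n y ≠ 0 := by
  obtain ⟨j, hj⟩ := exists_monomial_ne_zero (n := n) hy
  intro h
  apply hj
  have := eval_evForm (Pi.single j 1) y
  rw [h, map_zero] at this
  simpa [Pi.single_apply] using this.symm

/-- The coefficients of the binary form `∏ (bᵢ x - aᵢ y)` attached to vectors `vᵢ = (aᵢ, bᵢ)`. -/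
noncomputable def rootForm (v : Fin n → Fin 2 → k) : Fin (n + 1) → k :=
  binaryCoeffs n (∏ i, lin (v i))

theorem prod_lin_isHomogeneous (v : Fin n → Fin 2 → k) : (∏ i, lin (v i)).IsHomogeneous n := by
  simpa using IsHomogeneous.prod Finset.univ (fun i => lin (v i)) (fun _ => 1)
    (fun i _ => lin_isHomogeneous _)

theorem toForm_rootForm (v : Fin n → Fin 2 → k) : toForm (rootForm v) = ∏ i, lin (v i) :=
  toForm_binaryCoeffs (prod_lin_isHomogeneous v)

theorem eval_rootForm_evForm (v : Fin n → Fin 2 → k) (y : Fin 2 → k) :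
    eval (rootForm v) (evForm n y) = ∏ i, eval y (lin (v i)) := by
  rw [eval_evForm_eq_toForm, toForm_rootForm, map_prod]

theorem toForm_injective : Function.Injective (toForm : (Fin (n + 1) → k) → _) := fun w w' h => by
  rw [← binaryCoeffs_toForm w, h, binaryCoeffs_toForm]

theorem rootForm_ne_zero {v : Fin n → Fin 2 → k} (hv : ∀ i, v i ≠ 0) : rootForm v ≠ 0 := by
  intro h
  have h1 := toForm_rootForm v
  rw [h] at h1
  have : (∏ i, lin (v i)) ≠ 0 := Finset.prod_ne_zero_iff.2 fun i _ => lin_ne_zero (hv i)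
  exact this (by rw [← h1]; simp [toForm])

theorem toForm_smul (s : k) (w : Fin (n + 1) → k) : toForm (s • w) = C s * toForm w := by
  simp [toForm, Finset.mul_sum, C_mul_monomial]

theorem rootForm_smul (s : Fin n → k) (v : Fin n → Fin 2 → k) :
    rootForm (fun i => s i • v i) = (∏ i, s i) • rootForm v := by
  apply toForm_injective
  rw [toForm_smul, toForm_rootForm, toForm_rootForm]
  simp only [lin_smul, Finset.prod_mul_distrib, map_prod]

theorem rootForm_perm (σ : Equiv.Perm (Fin n)) (v : Fin n → Fin 2 → k) :
    rootForm (fun i => v (σ i)) = rootForm v := by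
  apply toForm_injective
  rw [toForm_rootForm, toForm_rootForm]
  exact Equiv.prod_comp σ fun i => lin (v i)

/-- The leading scalar of the factorization is absorbed into one root vector, which is why at least
one root is needed. -/
theorem exists_eq_rootForm [IsAlgClosed k] (hn : 1 ≤ n) {w : Fin (n + 1) → k} (hw : w ≠ 0) :
    ∃ v : Fin n → Fin 2 → k, (∀ i, v i ≠ 0) ∧ w = rootForm v := by
  have h0 : toForm w ≠ 0 := fun h => hw (toForm_injective (by rw [h]; simp [toForm]))
  obtain ⟨c, hc, v, hv, h⟩ := exists_eq_C_mul_prod_lin (toForm_isHomogeneous w) h0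
  have i0 : Fin n := ⟨0, hn⟩
  refine ⟨fun i => (if i = i0 then c else 1) • v i, fun i => ?_, ?_⟩
  · refine smul_ne_zero ?_ (hv i)
    split_ifs <;> simp [hc]
  · rw [rootForm_smul]
    apply toForm_injective
    rw [toForm_smul, toForm_rootForm, h]
    simp

/-- A binary form of degree `n` is determined up to a scalar by `n` distinct roots. -/
theorem exists_eq_smul_rootForm [IsAlgClosed k] (hn : 1 ≤ n) {v : Fin n → Fin 2 → k}
    (hv : ∀ i, v i ≠ 0) (hdist : ∀ i j, i ≠ j → eval (v j) (lin (v i)) ≠ 0)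
    {u : Fin (n + 1) → k} (hu : ∀ i, eval u (evForm n (v i)) = 0) : ∃ s : k, u = s • rootForm v := by
  by_cases hu0 : u = 0
  · exact ⟨0, by simp [hu0]⟩
  obtain ⟨v', hv', rfl⟩ := exists_eq_rootForm hn hu0
  have : ∀ i, ∃ j, ∃ s : k, v' j = s • v i := by
    intro i
    have := hu i
    rw [eval_rootForm_evForm, Finset.prod_eq_zero_iff] at this
    obtain ⟨j, -, hj⟩ := this
    rw [eval_lin_swap, neg_eq_zero] at hj
    exact ⟨j, exists_eq_smul_of_eval_lin_eq_zero (hv i) hj⟩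
  choose τ s hs using this
  have hs0 : ∀ i, s i ≠ 0 := fun i h => hv' (τ i) (by rw [hs, h, zero_smul])
  -- Each `v i` is a root of the form with root vectors `v'`; distinctness makes the matching `τ` a
  -- permutation.
  have hτ : Function.Injective τ := by
    intro i j hij
    by_contra hne
    apply hdist i j hne
    have h1 : s i • v i = s j • v j := by rw [← hs, ← hs, hij]
    have h2 : v j = ((s j)⁻¹ * s i) • v i := by
      rw [mul_smul, h1, smul_smul, inv_mul_cancel₀ (hs0 j), one_smul]
    rw [h2, eval_smul_of_isHomogeneous (lin_isHomogeneous _), eval_lin_self, mul_zero]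
  let σ := Equiv.ofBijective τ (Finite.injective_iff_bijective.1 hτ)
  refine ⟨∏ i, s i, ?_⟩
  rw [← rootForm_perm σ, ← rootForm_smul]
  exact congrArg rootForm (funext fun i => hs i)

end BinaryForms

/-! ### Irreducible components of hypersurfaces in `ℙⁿ`. -/

section Components

variable {k : Type*} [Field k] {n : ℕ}

theorem eval_rep_mk_eq_zero_iff {Φ : MvPolynomial (Fin (n + 1)) k} {m : ℕ}
    (h : Φ.IsHomogeneous m) {v : Fin (n + 1) → k} (hv : v ≠ 0) :
    eval (Projectivization.mk k v hv : PSpace k n).rep Φ = 0 ↔ eval v Φ = 0 := by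
  obtain ⟨s, hs⟩ := Projectivization.exists_smul_eq_mk_rep k v hv
  rw [← hs, Units.smul_def, eval_smul_of_isHomogeneous h]
  simp

theorem mk_mem_zeroLocus_singleton {Φ : MvPolynomial (Fin (n + 1)) k} {m : ℕ}
    (h : Φ.IsHomogeneous m) {v : Fin (n + 1) → k} (hv : v ≠ 0) :
    (Projectivization.mk k v hv : PSpace k n) ∈ zeroLocus {Φ} ↔ eval v Φ = 0 := by
  rw [← eval_rep_mk_eq_zero_iff h hv]
  simp [zeroLocus]

theorem mem_zeroLocus_singleton {Φ : MvPolynomial (Fin (n + 1)) k} {P : PSpace k n} :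
    P ∈ zeroLocus {Φ} ↔ eval P.rep Φ = 0 := by
  simp [zeroLocus]

theorem zeroLocus_mono_of_dvd {g Φ : MvPolynomial (Fin (n + 1)) k} (h : g ∣ Φ) :
    (zeroLocus {g} : Set (PSpace k n)) ⊆ zeroLocus {Φ} := by
  obtain ⟨Ψ, rfl⟩ := h
  intro P hP
  rw [mem_zeroLocus_singleton] at hP ⊢
  rw [map_mul, hP, zero_mul]

theorem isClosed_zariski_iff {A : Set (PSpace k n)} :
    @IsClosed _ (zariski k n) A ↔ IsAlgebraic A := by
  rw [← @isOpen_compl_iff _ _ (zariski k n)]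
  change Aᶜᶜ ∈ {A | IsAlgebraic A} ↔ _
  rw [compl_compl]
  rfl

theorem isClosed_zeroLocus_singleton {Φ : MvPolynomial (Fin (n + 1)) k} {m : ℕ}
    (h : Φ.IsHomogeneous m) : @IsClosed _ (zariski k n) (zeroLocus {Φ}) :=
  isClosed_zariski_iff.2 ⟨{Φ}, by rintro _ rfl; exact ⟨m, h⟩, rfl⟩

/-- A hypersurface meets every line of binary forms with prescribed remaining roots. -/
theorem exists_eval_rootForm_cons_eq_zero [IsAlgClosed k] {g : MvPolynomial (Fin (n + 2)) k}
    {m : ℕ} (h : g.IsHomogeneous m) (hm : m ≠ 0) (Q : Fin n → Fin 2 → k) :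
    ∃ x : Fin 2 → k, x ≠ 0 ∧
      eval (rootForm (Fin.cons x Q : Fin (n + 1) → Fin 2 → k)) g = 0 := by
  set Ψ := ∏ i, lin (Q i) with hΨ
  -- With the other roots fixed, the coefficients of `lin x * Ψ` are linear in the moving root `x`;
  -- `q` is this line, and restricting `g` to it gives a binary form.
  let q : Fin (n + 2) → MvPolynomial (Fin 2) k := fun j =>
    C (binaryCoeffs (n + 1) (X 0 * Ψ) j) * X 1 - C (binaryCoeffs (n + 1) (X 1 * Ψ) j) * X 0
  have hq : ∀ j, (q j).IsHomogeneous 1 := fun j =>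
    (isHomogeneous_C_mul_X _ _).sub (isHomogeneous_C_mul_X _ _)
  obtain ⟨x, hx, hx0⟩ := exists_eval_eq_zero_of_isHomogeneous (h.aeval q hq) (by simpa using hm)
  refine ⟨x, hx, ?_⟩
  rw [eval_aeval_eq] at hx0
  convert hx0 using 2
  congr 1
  funext j
  simp only [q, rootForm, Fin.prod_univ_succ, Fin.cons_zero, Fin.cons_succ, ← hΨ]
  simp only [binaryCoeffs, lin, sub_mul, mul_assoc, coeff_sub, coeff_C_mul, map_sub, map_mul, eval_C, eval_X]
  ring

theorem degree_ne_zero_of_irreducible {σ : Type*} {g : MvPolynomial σ k} (hg : Irreducible g)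
    {m : ℕ} (h : g.IsHomogeneous m) : m ≠ 0 := by
  rintro rfl
  have hC := totalDegree_eq_zero_iff_eq_C.1 ((totalDegree_zero_iff_isHomogeneous _).2 h)
  have hc : coeff 0 g ≠ 0 := fun hz => hg.ne_zero (by rw [hC, hz, map_zero])
  exact hg.not_isUnit (by rw [hC]; exact (isUnit_iff_ne_zero.2 hc).map C)

/-- An irreducible set inside the union of the loci of two factors lies in one of them; this is
iterated along a factorization of `J`. Factors of `J` are homogeneous, so their loci are closed. -/
theorem exists_irreducible_factor_of_subset {Z : Set (PSpace k n)}
    (hZ : @IsIrreducible _ (zariski k n) Z) {J : MvPolynomial (Fin (n + 1)) k} {m : ℕ}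
    (hJ : J.IsHomogeneous m) (hJ0 : J ≠ 0) (hsub : Z ⊆ zeroLocus {J}) :
    ∃ g, Irreducible g ∧ g ∣ J ∧ Z ⊆ zeroLocus {g} := by
  induction J using WfDvdMonoid.induction_on_irreducible generalizing m with
  | zero => exact absurd rfl hJ0
  | unit u hu =>
    obtain ⟨P, hP⟩ := hZ.1
    have h1 := mem_zeroLocus_singleton.1 (hsub hP)
    exact absurd h1 (hu.map (eval P.rep)).ne_zero
  | mul a i ha hi ih =>
    obtain ⟨b, hb⟩ := exists_isHomogeneous_of_dvd hJ hJ0 (Dvd.intro_left i rfl)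
    obtain ⟨c, hc⟩ := exists_isHomogeneous_of_dvd hJ hJ0 (Dvd.intro a rfl)
    have hcover : Z ⊆ zeroLocus {i} ∪ zeroLocus {a} := by
      intro P hP
      have h1 := mem_zeroLocus_singleton.1 (hsub hP)
      rw [map_mul, mul_eq_zero] at h1
      exact h1.imp mem_zeroLocus_singleton.2 mem_zeroLocus_singleton.2
    rcases (@isPreirreducible_iff_isClosed_union_isClosed _ (zariski k n) _).1 hZ.2 _ _
      (isClosed_zeroLocus_singleton hc) (isClosed_zeroLocus_singleton hb) hcover with h1 | h1
    · exact ⟨i, hi, Dvd.intro a rfl, h1⟩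
    · obtain ⟨g, hg, hga, hgZ⟩ := ih hb ha h1
      exact ⟨g, hg, hga.mul_left i, hgZ⟩

variable [IsAlgClosed k]

theorem zeroLocus_singleton_nonempty (hn : 1 ≤ n) {g : MvPolynomial (Fin (n + 1)) k} {m : ℕ}
    (h : g.IsHomogeneous m) (hm : m ≠ 0) : (zeroLocus {g} : Set (PSpace k n)).Nonempty := by
  obtain ⟨n, rfl⟩ : ∃ l, n = l + 1 := ⟨n - 1, by omega⟩
  obtain ⟨x, hx, hx0⟩ := exists_eval_rootForm_cons_eq_zero h hm fun _ => ![1, 0]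
  have hne : rootForm (Fin.cons x fun _ => ![1, 0] : Fin (n + 1) → Fin 2 → k) ≠ 0 :=
    rootForm_ne_zero fun i => by
      induction i using Fin.cases with
      | zero => simpa using hx
      | succ i => simp
  exact ⟨_, (mk_mem_zeroLocus_singleton h hne).2 hx0⟩

theorem dvd_of_zeroLocus_subset (hn : 1 ≤ n) {g Φ : MvPolynomial (Fin (n + 1)) k} {m a : ℕ}
    (hg : Irreducible g) (h : g.IsHomogeneous m) (hΦ : Φ.IsHomogeneous a)
    (hv : ∀ P ∈ (zeroLocus {g} : Set (PSpace k n)), eval P.rep Φ = 0) : g ∣ Φ := by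
  have key : ∀ v, v ≠ 0 → eval v g = 0 → eval v Φ = 0 := fun v hv0 hvg =>
    (eval_rep_mk_eq_zero_iff hΦ hv0).1 (hv _ ((mk_mem_zeroLocus_singleton h hv0).2 hvg))
  refine dvd_of_forall_eval_eq_zero hg fun v hvg => ?_
  by_cases hv0 : v = 0
  -- The origin is no projective point: its value is obtained by scaling a point of the nonempty
  -- locus of `g` by zero, which also covers `Φ` constant.
  · subst hv0
    obtain ⟨P, hP⟩ := zeroLocus_singleton_nonempty hn h (degree_ne_zero_of_irreducible hg h)
    have := eval_smul_of_isHomogeneous hΦ 0 P.rep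
    rwa [hv P hP, mul_zero, zero_smul] at this
  · exact key v hv0 hvg

theorem isIrreducible_zeroLocus_singleton (hn : 1 ≤ n) {g : MvPolynomial (Fin (n + 1)) k} {m : ℕ}
    (hg : Irreducible g) (h : g.IsHomogeneous m) :
    @IsIrreducible _ (zariski k n) (zeroLocus {g}) := by
  refine ⟨zeroLocus_singleton_nonempty hn h (degree_ne_zero_of_irreducible hg h), ?_⟩
  rw [@isPreirreducible_iff_isClosed_union_isClosed _ (zariski k n)]
  intro A B hA hB hAB
  obtain ⟨S, hS, rfl⟩ := isClosed_zariski_iff.1 hA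
  obtain ⟨T, hT, rfl⟩ := isClosed_zariski_iff.1 hB
  by_contra! hcon
  simp only [Set.not_subset, zeroLocus, Set.mem_ofPred_eq, not_forall] at hcon
  obtain ⟨⟨P, hP, Φ, hΦ, hPΦ⟩, ⟨Q, hQ, Ψ, hΨ, hQΨ⟩⟩ := hcon
  obtain ⟨a, ha⟩ := hS Φ hΦ
  obtain ⟨b, hb⟩ := hT Ψ hΨ
  have hdvd : g ∣ Φ * Ψ := by
    refine dvd_of_zeroLocus_subset hn hg h (ha.mul hb) fun R hR => ?_
    rw [map_mul]
    rcases hAB hR with hR | hR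
    · rw [hR Φ hΦ, zero_mul]
    · rw [hR Ψ hΨ, mul_zero]
  rcases hg.prime.dvd_or_dvd hdvd with hd | hd
  · exact hPΦ (mem_zeroLocus_singleton.1 (zeroLocus_mono_of_dvd hd hP))
  · exact hQΨ (mem_zeroLocus_singleton.1 (zeroLocus_mono_of_dvd hd hQ))

/-- The irreducible components of a hypersurface are the zero loci of the irreducible factors. -/
theorem isIrredComponent_zeroLocus_singleton_iff (hn : 1 ≤ n) {J : MvPolynomial (Fin (n + 1)) k}
    {m : ℕ} (hJ : J.IsHomogeneous m) (hJ0 : J ≠ 0) (Z : Set (PSpace k n)) :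
    IsIrredComponent Z (zeroLocus {J}) ↔ ∃ g, Irreducible g ∧ g ∣ J ∧ Z = zeroLocus {g} := by
  constructor
  · intro hZ
    obtain ⟨g, hg, hgJ, hsub⟩ := exists_irreducible_factor_of_subset hZ.1.1 hJ hJ0 hZ.1.2
    obtain ⟨a, ha⟩ := exists_isHomogeneous_of_dvd hJ hJ0 hgJ
    exact ⟨g, hg, hgJ, hsub.antisymm (hZ.2 ⟨isIrreducible_zeroLocus_singleton hn hg ha,
      zeroLocus_mono_of_dvd hgJ⟩ hsub)⟩
  · rintro ⟨g, hg, hgJ, rfl⟩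
    obtain ⟨a, ha⟩ := exists_isHomogeneous_of_dvd hJ hJ0 hgJ
    refine ⟨⟨isIrreducible_zeroLocus_singleton hn hg ha, zeroLocus_mono_of_dvd hgJ⟩, ?_⟩
    rintro Y ⟨hY, hYJ⟩ hgY
    -- A larger irreducible `Y` lies in the locus of an irreducible factor `g'`; then `g ∣ g'`, so
    -- they are associated and `Y` is no larger.
    obtain ⟨g', hg', hgJ', hsub⟩ := exists_irreducible_factor_of_subset hY hJ hJ0 hYJ
    obtain ⟨b, hb⟩ := exists_isHomogeneous_of_dvd hJ hJ0 hgJ'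
    have hd : g ∣ g' := dvd_of_zeroLocus_subset hn hg ha hb fun P hP =>
      mem_zeroLocus_singleton.1 (hsub (hgY hP))
    exact hsub.trans (zeroLocus_mono_of_dvd (hg.associated_of_dvd hg' hd).symm.dvd)

end Components

/-! ### Norms of binary forms and the construction of the symmetric power. -/

section SymmetricPower

variable {k : Type*} [Field k] {n d : ℕ}

namespace ProjEnd

/-- The affine lift of an endomorphism of `ℙⁿ`. -/
noncomputable def lift (F : ProjEnd k n d) (v : Fin (n + 1) → k) : Fin (n + 1) → k :=
  fun i => eval v (F.form i)

theorem lift_ne_zero (F : ProjEnd k n d) {v : Fin (n + 1) → k} (hv : v ≠ 0) : F.lift v ≠ 0 :=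
  fun h => hv (F.eq_zero_of_forall_eval v fun i => congrFun h i)

theorem lift_smul (F : ProjEnd k n d) (s : k) (v : Fin (n + 1) → k) :
    F.lift (s • v) = s ^ d • F.lift v :=
  funext fun i => eval_smul_of_isHomogeneous (F.homogeneous i) s v

theorem map_mk (F : ProjEnd k n d) {v : Fin (n + 1) → k} (hv : v ≠ 0) :
    F.map (Projectivization.mk k v hv) = Projectivization.mk k (F.lift v) (F.lift_ne_zero hv) := by
  obtain ⟨s, hs⟩ := Projectivization.exists_smul_eq_mk_rep k v hv
  rw [map, Projectivization.mk_eq_mk_iff']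
  refine ⟨(s : k) ^ d, ?_⟩
  rw [← lift_smul, ← Units.smul_def, hs]
  rfl

end ProjEnd

theorem vieta_mk {v : Fin n → Fin 2 → k} (hv : ∀ i, v i ≠ 0) :
    vieta (fun i => (Projectivization.mk k (v i) (hv i) : PSpace k 1)) =
      Projectivization.mk k (rootForm v) (rootForm_ne_zero hv) := by
  have h : ∀ i, ∃ s : k, s • v i = (Projectivization.mk k (v i) (hv i) : PSpace k 1).rep :=
    fun i => by
      obtain ⟨s, hs⟩ := Projectivization.exists_smul_eq_mk_rep k (v i) (hv i)
      exact ⟨s, hs⟩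
  choose s hs using h
  rw [vieta, Projectivization.mk_eq_mk_iff']
  refine ⟨∏ i, s i, ?_⟩
  rw [← rootForm_smul]
  simp only [hs]
  rfl

theorem vieta_surjective [IsAlgClosed k] (hn : 1 ≤ n) :
    Function.Surjective (vieta : (Fin n → PSpace k 1) → PSpace k n) := by
  intro P
  induction P using Projectivization.ind with
  | h w hw =>
    obtain ⟨v, hv, rfl⟩ := exists_eq_rootForm hn hw
    exact ⟨_, vieta_mk hv⟩

theorem rootForm_surjective [IsAlgClosed k] (hn : 1 ≤ n) :
    Function.Surjective (rootForm : (Fin n → Fin 2 → k) → Fin (n + 1) → k) := by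
  intro w
  by_cases hw : w = 0
  · refine ⟨fun _ => 0, ?_⟩
    rw [hw]
    apply toForm_injective
    rw [toForm_rootForm]
    have : n ≠ 0 := by omega
    simp [toForm, lin, this]
  · obtain ⟨v, -, rfl⟩ := exists_eq_rootForm hn hw
    exact ⟨v, rfl⟩

/-- `T` is the norm of the binary form `g`: its value at a product of linear forms is the product
of the values of `g` at the roots. -/
def IsNorm (n : ℕ) (g : MvPolynomial (Fin 2) k) (T : MvPolynomial (Fin (n + 1)) k) : Prop :=
  ∀ v : Fin n → Fin 2 → k, eval (rootForm v) T = ∏ i, eval (v i) g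

theorem IsNorm.mul {g h : MvPolynomial (Fin 2) k} {T U : MvPolynomial (Fin (n + 1)) k}
    (hg : IsNorm n g T) (hh : IsNorm n h U) : IsNorm n (g * h) (T * U) := fun v => by
  rw [map_mul, hg, hh, ← Finset.prod_mul_distrib]
  simp only [map_mul]

theorem isNorm_C (c : k) : IsNorm n (C c) (C (c ^ n)) := fun v => by simp

theorem isNorm_lin (y : Fin 2 → k) : IsNorm n (lin y) (C ((-1) ^ n) * evForm n y) := fun v => by
  rw [map_mul, eval_C, eval_rootForm_evForm]
  simp only [eval_lin_swap y, Finset.prod_neg]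
  simp

/-- Norms are multiplicative, and the norm of a linear form with root `y` is, up to sign, evaluation
at `y`. -/
theorem exists_isNorm [IsAlgClosed k] {g : MvPolynomial (Fin 2) k} (h : g.IsHomogeneous d)
    (h0 : g ≠ 0) (n : ℕ) :
    ∃ T : MvPolynomial (Fin (n + 1)) k, T.IsHomogeneous d ∧ IsNorm n g T := by
  refine binaryForm_induction (motive := fun d g =>
    ∃ T : MvPolynomial (Fin (n + 1)) k, T.IsHomogeneous d ∧ IsNorm n g T) ?_ ?_ h h0
  · exact fun c _ => ⟨_, isHomogeneous_C _ _, isNorm_C c⟩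
  · rintro m v Φ - - ⟨T, hT, hN⟩
    exact ⟨_, add_comm 1 m ▸ ((evForm_isHomogeneous v).C_mul _).mul hT, (isNorm_lin v).mul hN⟩

/-- The binary form vanishing on the fibre of `f` over `y`. -/
noncomputable def fiberForm (f : ProjEnd k 1 d) (y : Fin 2 → k) : MvPolynomial (Fin 2) k :=
  C (y 0) * f.form 1 - C (y 1) * f.form 0

theorem eval_fiberForm (f : ProjEnd k 1 d) (y x : Fin 2 → k) :
    eval x (fiberForm f y) = eval y (lin (f.lift x)) := by
  simp [fiberForm, eval_lin, ProjEnd.lift]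
  ring

theorem fiberForm_isHomogeneous (f : ProjEnd k 1 d) (y : Fin 2 → k) :
    (fiberForm f y).IsHomogeneous d :=
  ((f.homogeneous 1).C_mul _).sub ((f.homogeneous 0).C_mul _)

/-- Otherwise `f` would be constant with value `y`, and a zero of one coordinate form would be a
common zero of both. -/
theorem fiberForm_ne_zero [IsAlgClosed k] (hd : 1 ≤ d) (f : ProjEnd k 1 d) {y : Fin 2 → k}
    (hy : y ≠ 0) : fiberForm f y ≠ 0 := by
  intro h
  have key : ∀ x, y 0 * eval x (f.form 1) = y 1 * eval x (f.form 0) := fun x => by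
    have : eval x (fiberForm f y) = 0 := by rw [h, map_zero]
    simpa [fiberForm, sub_eq_zero] using this
  by_cases h0 : y 0 = 0
  · have h1 : y 1 ≠ 0 := fun h1 => hy (by funext i; fin_cases i <;> simp [h0, h1])
    obtain ⟨x, hx, hx0⟩ := exists_eval_eq_zero_of_isHomogeneous (f.homogeneous 1) (by omega)
    have hk := key x
    rw [hx0, mul_zero, eq_comm, mul_eq_zero] at hk
    exact hx (f.eq_zero_of_forall_eval x fun i => by
      fin_cases i
      · exact hk.resolve_left h1
      · exact hx0)
  · obtain ⟨x, hx, hx0⟩ := exists_eval_eq_zero_of_isHomogeneous (f.homogeneous 0) (by omega)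
    have hk := key x
    rw [hx0, mul_zero, mul_eq_zero] at hk
    exact hx (f.eq_zero_of_forall_eval x fun i => by
      fin_cases i
      · exact hx0
      · exact hk.resolve_left h0)

/-- A lift of the symmetric power that is compatible with products of linear forms exactly, and not
only up to a scalar. -/
def IsSymmetricLift (f : ProjEnd k 1 d) (F : ProjEnd k n d) : Prop :=
  ∀ v : Fin n → Fin 2 → k, F.lift (rootForm v) = rootForm fun i => f.lift (v i)

theorem IsSymmetricLift.isSymmetricPower {f : ProjEnd k 1 d} {F : ProjEnd k n d}
    (h : IsSymmetricLift f F) : IsSymmetricPower f F := by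
  intro P
  have hP : P = fun i => Projectivization.mk k (P i).rep (P i).rep_nonzero :=
    funext fun i => ((P i).mk_rep).symm
  have h2 : (fun i => f.map (P i)) = fun i => Projectivization.mk k (f.lift (P i).rep)
      (f.lift_ne_zero (P i).rep_nonzero) := rfl
  rw [h2, vieta_mk]
  conv_lhs => rw [hP]
  rw [vieta_mk (fun i => (P i).rep_nonzero), ProjEnd.map_mk]
  simp only [h _]

/-- The norm of the fibre form over `y` is the value at `y` of the image form. Interpolation at `n +
1` points recovers the coefficients as linear combinations of these norms. -/
theorem exists_isSymmetricLift [IsAlgClosed k] [CharZero k] (hn : 1 ≤ n) (hd : 1 ≤ d)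
    (f : ProjEnd k 1 d) : ∃ F : ProjEnd k n d, IsSymmetricLift f F := by
  -- The interpolation points `(i : 1)` are distinct in characteristic zero, so their Vandermonde
  -- matrix is invertible.
  let y : Fin (n + 1) → Fin 2 → k := fun i => ![((i : ℕ) : k), 1]
  have hy : ∀ i, y i ≠ 0 := fun i h => by simpa [y] using congrFun h 1
  choose T hT hTn using fun i => exists_isNorm (fiberForm_isHomogeneous f (y i))
    (fiberForm_ne_zero hd f (hy i)) n
  let M : Matrix (Fin (n + 1)) (Fin (n + 1)) k :=
    Matrix.vandermonde fun i : Fin (n + 1) => ((i : ℕ) : k)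
  have hM : IsUnit M.det := by
    rw [isUnit_iff_ne_zero, Matrix.det_vandermonde_ne_zero_iff]
    intro i j hij
    exact Fin.ext (Nat.cast_injective (R := k) hij)
  let form : Fin (n + 1) → MvPolynomial (Fin (n + 1)) k := fun j => ∑ i, C (M⁻¹ j i) * T i
  have hform : ∀ v : Fin n → Fin 2 → k,
      (fun j => eval (rootForm v) (form j)) = rootForm fun i => f.lift (v i) := by
    intro v
    have h1 : (fun j => eval (rootForm v) (form j)) =
        M⁻¹.mulVec fun i => eval (rootForm v) (T i) := by
      funext j
      simp [form, Matrix.mulVec, dotProduct]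
    have h2 : (fun i => eval (rootForm v) (T i)) = M.mulVec (rootForm fun i => f.lift (v i)) := by
      funext i
      rw [hTn]
      simp only [eval_fiberForm]
      rw [← eval_rootForm_evForm, eval_evForm]
      simp [M, y, Matrix.mulVec, dotProduct, Matrix.vandermonde_apply]
    rw [h1, h2, Matrix.mulVec_mulVec, Matrix.nonsing_inv_mul _ hM, Matrix.one_mulVec]
  refine ⟨⟨form, fun j => IsHomogeneous.sum _ _ _ fun i _ => (hT i).C_mul _, ?_⟩, hform⟩
  intro w hw
  by_contra hw0
  obtain ⟨v, hv, rfl⟩ := exists_eq_rootForm hn hw0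
  have := hform v
  rw [show (fun j => eval (rootForm v) (form j)) = 0 from funext hw] at this
  exact rootForm_ne_zero (fun i => f.lift_ne_zero (hv i)) this.symm

theorem IsSymmetricPower.map_eq [IsAlgClosed k] (hn : 1 ≤ n) {f : ProjEnd k 1 d}
    {F G : ProjEnd k n d} (hF : IsSymmetricPower f F) (hG : IsSymmetricPower f G) :
    F.map = G.map := by
  funext P
  obtain ⟨Q, rfl⟩ := vieta_surjective hn P
  rw [hF, hG]

/-- The evaluation of a symmetric power at `y` is the norm of the form cutting out the fibre over
`y`. -/
theorem IsSymmetricLift.sum_eq_norm [IsAlgClosed k] (hn : 1 ≤ n) {f : ProjEnd k 1 d}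
    {F : ProjEnd k n d} (h : IsSymmetricLift f F) {y : Fin 2 → k}
    {T : MvPolynomial (Fin (n + 1)) k} (hT : IsNorm n (fiberForm f y) T) :
    ∑ j : Fin (n + 1), C (y 0 ^ (j : ℕ) * y 1 ^ (n - (j : ℕ))) * F.form j = T := by
  refine MvPolynomial.funext fun w => ?_
  obtain ⟨v, rfl⟩ := rootForm_surjective hn w
  rw [hT]
  simp only [eval_fiberForm]
  rw [← eval_rootForm_evForm, ← h v, eval_evForm]
  simp [ProjEnd.lift]

end SymmetricPower

/-! ### Directional derivatives and the Jacobian. -/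

section Jacobian

variable {k : Type*} [Field k] {n d : ℕ}

/-- The derivative of `Φ` at `w` in the direction `u`. -/
noncomputable def dirDeriv (Φ : MvPolynomial (Fin (n + 1)) k) (w u : Fin (n + 1) → k) : k :=
  ∑ j, eval w (pderiv j Φ) * u j

theorem dirDeriv_mul (Φ Ψ : MvPolynomial (Fin (n + 1)) k) (w u : Fin (n + 1) → k) :
    dirDeriv (Φ * Ψ) w u = dirDeriv Φ w u * eval w Ψ + eval w Φ * dirDeriv Ψ w u := by
  simp only [dirDeriv, Derivation.leibniz, smul_eq_mul, map_add, map_mul, Finset.sum_mul,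
    Finset.mul_sum, ← Finset.sum_add_distrib]
  exact Finset.sum_congr rfl fun j _ => by ring

theorem dirDeriv_sum {ι : Type*} (s : Finset ι) (Φ : ι → MvPolynomial (Fin (n + 1)) k)
    (w u : Fin (n + 1) → k) : dirDeriv (∑ i ∈ s, Φ i) w u = ∑ i ∈ s, dirDeriv (Φ i) w u := by
  simp only [dirDeriv, map_sum, Finset.sum_mul]
  exact Finset.sum_comm

theorem dirDeriv_C_mul (c : k) (Φ : MvPolynomial (Fin (n + 1)) k) (w u : Fin (n + 1) → k) :
    dirDeriv (C c * Φ) w u = c * dirDeriv Φ w u := by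
  simp [dirDeriv, Finset.mul_sum, mul_assoc]

theorem dirDeriv_X (j : Fin (n + 1)) (w u : Fin (n + 1) → k) : dirDeriv (X j) w u = u j := by
  simp [dirDeriv, pderiv_X, Pi.single_apply, apply_ite]

theorem dirDeriv_self {Φ : MvPolynomial (Fin (n + 1)) k} (h : Φ.IsHomogeneous d)
    (w : Fin (n + 1) → k) : dirDeriv Φ w w = d * eval w Φ := by
  have := congrArg (eval w) h.sum_X_mul_pderiv
  simp only [map_sum, map_mul, eval_X, nsmul_eq_mul, map_natCast] at this
  rw [← this, dirDeriv]
  exact Finset.sum_congr rfl fun j _ => mul_comm _ _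

theorem dirDeriv_smul_right (Φ : MvPolynomial (Fin (n + 1)) k) (w u : Fin (n + 1) → k) (s : k) :
    dirDeriv Φ w (s • u) = s * dirDeriv Φ w u := by
  simp only [dirDeriv, Finset.mul_sum, Pi.smul_apply, smul_eq_mul]
  exact Finset.sum_congr rfl fun j _ => by ring

theorem dirDeriv_sub_right (Φ : MvPolynomial (Fin (n + 1)) k) (w u u' : Fin (n + 1) → k) :
    dirDeriv Φ w (u - u') = dirDeriv Φ w u - dirDeriv Φ w u' := by
  simp [dirDeriv, mul_sub]

theorem dirDeriv_evForm (y : Fin 2 → k) (w u : Fin (n + 1) → k) :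
    dirDeriv (evForm n y) w u = eval u (evForm n y) := by
  rw [evForm, dirDeriv_sum, map_sum]
  exact Finset.sum_congr rfl fun j _ => by rw [dirDeriv_C_mul, dirDeriv_X, map_mul, eval_C, eval_X]

theorem dirDeriv_eq_add (Φ : MvPolynomial (Fin 2) k) (w u : Fin 2 → k) :
    dirDeriv Φ w u = eval w (pderiv 0 Φ) * u 0 + eval w (pderiv 1 Φ) * u 1 :=
  Fin.sum_univ_two _

theorem dirDeriv_lin (y w u : Fin 2 → k) : dirDeriv (lin y) w u = eval u (lin y) := by
  simp [dirDeriv_eq_add, lin, pderiv_X]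
  ring

namespace ProjEnd

theorem eval_jacobian (F : ProjEnd k n d) (w : Fin (n + 1) → k) :
    eval w F.jacobian = (Matrix.of fun i j => eval w (pderiv j (F.form i))).det := by
  rw [jacobian, RingHom.map_det]
  rfl

theorem eval_jacobian_eq_zero_iff (F : ProjEnd k n d) (w : Fin (n + 1) → k) :
    eval w F.jacobian = 0 ↔ ∃ u ≠ 0, ∀ i, dirDeriv (F.form i) w u = 0 := by
  rw [eval_jacobian, ← Matrix.exists_mulVec_eq_zero_iff]
  simp only [funext_iff (f := Matrix.mulVec _ _)]
  rfl

theorem jacobian_isHomogeneous (F : ProjEnd k n d) :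
    F.jacobian.IsHomogeneous ((n + 1) * (d - 1)) := by
  rw [jacobian, Matrix.det_apply]
  refine IsHomogeneous.sum _ _ _ fun σ _ => ?_
  have h : (∏ i, (Matrix.of fun i j => pderiv j (F.form i)) (σ i) i).IsHomogeneous
      ((n + 1) * (d - 1)) := by
    simpa using IsHomogeneous.prod Finset.univ
      (fun i => (Matrix.of fun i j => pderiv j (F.form i)) (σ i) i) (fun _ => d - 1)
      fun i _ => (F.homogeneous (σ i)).pderiv
  rcases Int.units_eq_one_or (Equiv.Perm.sign σ) with hs | hs
  · rwa [hs, one_smul]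
  · rw [hs, Units.neg_smul, one_smul]
    exact h.neg

theorem mk_mem_criticalLocus (F : ProjEnd k n d) {v : Fin (n + 1) → k} (hv : v ≠ 0) :
    Projectivization.mk k v hv ∈ F.criticalLocus ↔ eval v F.jacobian = 0 :=
  mk_mem_zeroLocus_singleton F.jacobian_isHomogeneous hv

theorem form_mul_form_eq_of_map_eq [Infinite k] (hd : 1 ≤ d) {F G : ProjEnd k n d}
    (h : F.map = G.map) (i j : Fin (n + 1)) : F.form i * G.form j = F.form j * G.form i := by
  refine MvPolynomial.funext fun w => ?_
  by_cases hw : w = 0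
  · have hz : ∀ i, eval w (F.form i) = 0 := fun i => by
      rw [hw, eval_zero_of_isHomogeneous (F.homogeneous i) (by omega)]
    rw [map_mul, map_mul, hz, hz, zero_mul, zero_mul]
  · have := congrFun h (Projectivization.mk k w hw)
    rw [map_mk, map_mk, Projectivization.mk_eq_mk_iff'] at this
    obtain ⟨s, hs⟩ := this
    have hz : ∀ i, eval w (F.form i) = s * eval w (G.form i) := fun i => (congrFun hs i).symm
    rw [map_mul, map_mul, hz, hz]
    ring

/-- This transfers the critical locus from the exact lift to an arbitrary `F` inducing the same map.
Differentiating `Fᵢ Gⱼ = Fⱼ Gᵢ` shows that a kernel vector of the derivative of `F` is sent by that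
of `G` to a multiple of `G(w)`. -/
theorem criticalLocus_subset_of_map_eq [CharZero k] (hd : 1 ≤ d) {F G : ProjEnd k n d}
    (h : F.map = G.map) : F.criticalLocus ⊆ G.criticalLocus := by
  intro P
  induction P using Projectivization.ind with
  | h w hw =>
    rw [mk_mem_criticalLocus, mk_mem_criticalLocus, eval_jacobian_eq_zero_iff,
      eval_jacobian_eq_zero_iff]
    rintro ⟨u, hu, hFu⟩
    have hd0 : (d : k) ≠ 0 := by exact_mod_cast (by omega : d ≠ 0)
    obtain ⟨i₀, hi₀⟩ : ∃ i, eval w (G.form i) ≠ 0 := by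
      by_contra! hcon
      exact hw (G.eq_zero_of_forall_eval w hcon)
    obtain ⟨i₁, hi₁⟩ : ∃ i, eval w (F.form i) ≠ 0 := by
      by_contra! hcon
      exact hw (F.eq_zero_of_forall_eval w hcon)
    have hFG : ∀ i j, eval w (F.form i) * eval w (G.form j) =
        eval w (F.form j) * eval w (G.form i) := fun i j => by
      simpa using congrArg (eval w) (form_mul_form_eq_of_map_eq hd h i j)
    have hder : ∀ i j, eval w (F.form i) * dirDeriv (G.form j) w u =
        eval w (F.form j) * dirDeriv (G.form i) w u := fun i j => by
      have := congrArg (fun Φ => dirDeriv Φ w u) (form_mul_form_eq_of_map_eq hd h i j)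
      simpa [dirDeriv_mul, hFu] using this
    have hGi₁ : eval w (G.form i₁) ≠ 0 := fun hz => by
      have := hFG i₁ i₀
      rw [hz, mul_zero] at this
      exact mul_ne_zero hi₁ hi₀ this
    -- By Euler's identity the derivative of `G` sends `w` to `d G(w)`; this `s` makes `u - s w` a
    -- kernel vector.
    set s : k := dirDeriv (G.form i₁) w u / (d * eval w (G.form i₁)) with hs
    refine ⟨u - s • w, fun h0 => ?_, fun i => ?_⟩
    · have hus : u = s • w := sub_eq_zero.1 h0
      have h1 := hFu i₁
      rw [hus, dirDeriv_smul_right, dirDeriv_self (F.homogeneous i₁)] at h1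
      have hs0 : s = 0 := by
        rcases mul_eq_zero.1 h1 with h1 | h1
        · exact h1
        · exact absurd h1 (mul_ne_zero hd0 hi₁)
      exact hu (by rw [hus, hs0, zero_smul])
    · rw [dirDeriv_sub_right, dirDeriv_smul_right, dirDeriv_self (G.homogeneous i), hs]
      have h1 := hder i i₁
      have h2 := hFG i i₁
      field_simp
      apply mul_left_cancel₀ hi₁
      linear_combination (-eval w (G.form i₁)) * h1 + dirDeriv (G.form i₁) w u * h2

theorem criticalLocus_eq_of_map_eq [CharZero k] (hd : 1 ≤ d) {F G : ProjEnd k n d}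
    (h : F.map = G.map) : F.criticalLocus = G.criticalLocus :=
  (criticalLocus_subset_of_map_eq hd h).antisymm (criticalLocus_subset_of_map_eq hd h.symm)

/-- The Jacobian of `f` at `c` measures the multiplicity of `c` in its fibre. -/
theorem eval_jacobian_of_fiberForm_eq (f : ProjEnd k 1 d) {c : Fin 2 → k} (hc : c ≠ 0)
    {h : MvPolynomial (Fin 2) k} (hf : fiberForm f (f.lift c) = lin c * h) :
    eval c f.jacobian = -(d * eval c h) := by
  obtain ⟨u, hu⟩ := exists_eval_lin_ne_zero hc
  -- The direction `u` is independent of `c`, so differentiating `lin c * h` along it at `c`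
  -- isolates `h(c)`; Euler's identity relates this to the determinant.
  apply mul_right_cancel₀ hu
  have h1 : dirDeriv (fiberForm f (f.lift c)) c u = eval u (lin c) * eval c h := by
    rw [hf, dirDeriv_mul, dirDeriv_lin, eval_lin_self, zero_mul, add_zero]
  have e0 := dirDeriv_self (f.homogeneous 0) c
  have e1 := dirDeriv_self (f.homogeneous 1) c
  simp only [dirDeriv_eq_add, fiberForm, lift, map_sub, pderiv_C_mul, eval_lin, map_mul,
    eval_C] at h1 e0 e1 ⊢
  rw [eval_jacobian, Matrix.det_fin_two]
  simp only [Matrix.of_apply]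
  linear_combination -(d : k) * h1 - (eval c (pderiv 0 (f.form 1)) * u 0 +
    eval c (pderiv 1 (f.form 1)) * u 1) * e0 + (eval c (pderiv 0 (f.form 0)) * u 0 +
    eval c (pderiv 1 (f.form 0)) * u 1) * e1

end ProjEnd

end Jacobian

/-! ### Critical points of `f` and of its symmetric power. -/

section CriticalPoints

variable {k : Type*} [Field k] {n d : ℕ}

theorem derivative_dehomogenize (Φ : MvPolynomial (Fin 2) k) :
    Polynomial.derivative (dehomogenize Φ) = dehomogenize (pderiv 0 Φ) := by
  induction Φ using MvPolynomial.induction_on with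
  | C a => simp [dehomogenize]
  | add p q hp hq => simp [hp, hq]
  | mul_X p i hp =>
    rw [map_mul, Polynomial.derivative_mul, hp, Derivation.leibniz]
    fin_cases i
    · simp [dehomogenize]; ring
    · simp [dehomogenize]

theorem natCast_ne_zero_of_one_le [CharZero k] (hd : 1 ≤ d) : (d : k) ≠ 0 := by
  exact_mod_cast (by omega : d ≠ 0)

variable [IsAlgClosed k]

theorem exists_fiberForm_eq (f : ProjEnd k 1 d) {c : Fin 2 → k} (hc : c ≠ 0) :
    ∃ h, fiberForm f (f.lift c) = lin c * h :=
  lin_dvd (fiberForm_isHomogeneous f _) hc (by rw [eval_fiberForm, eval_lin_self])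

theorem exists_isHomogeneous_of_fiberForm_dvd (hd : 1 ≤ d) (f : ProjEnd k 1 d) {y : Fin 2 → k}
    (hy : y ≠ 0) {h : MvPolynomial (Fin 2) k} (hh : h ∣ fiberForm f y) :
    h ≠ 0 ∧ ∃ m, h.IsHomogeneous m :=
  ⟨ne_zero_of_dvd_ne_zero (fiberForm_ne_zero hd f hy) hh,
    exists_isHomogeneous_of_dvd (fiberForm_isHomogeneous f y) (fiberForm_ne_zero hd f hy) hh⟩

/-- Forms with a root at a critical point of `f` are critical for the symmetric power. -/
theorem IsSymmetricLift.eval_jacobian_eq_zero [CharZero k] (hn : 1 ≤ n) (hd : 1 ≤ d)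
    {f : ProjEnd k 1 d} {F : ProjEnd k n d} (hF : IsSymmetricLift f F) {c : Fin 2 → k} (hc : c ≠ 0)
    (hcrit : eval c f.jacobian = 0) {w : Fin (n + 1) → k} (hw : eval w (evForm n c) = 0) :
    eval w F.jacobian = 0 := by
  have hy := f.lift_ne_zero hc
  obtain ⟨h, hh⟩ := exists_fiberForm_eq f hc
  obtain ⟨h0, m, hm⟩ := exists_isHomogeneous_of_fiberForm_dvd hd f hy (Dvd.intro_left _ hh.symm)
  have hhc : eval c h = 0 := by
    have := f.eval_jacobian_of_fiberForm_eq hc hh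
    rw [hcrit, eq_comm, neg_eq_zero, mul_eq_zero] at this
    exact this.resolve_left (natCast_ne_zero_of_one_le hd)
  obtain ⟨h', rfl⟩ := lin_dvd hm hc hhc
  obtain ⟨h0', m', hm'⟩ := exists_isHomogeneous_of_fiberForm_dvd hd f hy (h := h')
    (by rw [hh, ← mul_assoc]; exact Dvd.intro_left _ rfl)
  obtain ⟨T, -, hT⟩ := exists_isNorm hm' h0' n
  -- A critical `c` is a double root of its fibre form, so the norm is divisible by the square of
  -- `evForm n c`, and its gradient vanishes on that hyperplane.
  have hnorm : IsNorm n (fiberForm f (f.lift c)) _ :=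
    hh ▸ (isNorm_lin c).mul ((isNorm_lin c).mul hT)
  have hsum := hF.sum_eq_norm hn hnorm
  obtain ⟨j₀, hj₀⟩ := exists_monomial_ne_zero (n := n) hy
  rw [ProjEnd.eval_jacobian, ← Matrix.exists_vecMul_eq_zero_iff]
  -- The norm is the combination of the coordinate forms with these weights, evaluation at `f(c)`;
  -- its zero gradient is a linear relation between the rows of the Jacobian matrix.
  refine ⟨fun j => f.lift c 0 ^ (j : ℕ) * f.lift c 1 ^ (n - (j : ℕ)),
    fun hz => hj₀ (congrFun hz j₀), ?_⟩
  funext i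
  have := congrArg (fun Φ => eval w (pderiv i Φ)) hsum
  simp only [map_sum, Derivation.leibniz, smul_eq_mul, map_add, map_mul,
    hw, mul_zero, zero_mul, add_zero] at this
  simpa [Matrix.vecMul, dotProduct] using this

/-- Forms whose roots are noncritical for `f` and have distinct images are noncritical for the
symmetric power. -/
theorem IsSymmetricLift.eval_jacobian_ne_zero [CharZero k] (hn : 1 ≤ n) (hd : 1 ≤ d)
    {f : ProjEnd k 1 d} {F : ProjEnd k n d} (hF : IsSymmetricLift f F) {v : Fin n → Fin 2 → k}
    (hv : ∀ i, v i ≠ 0) (hcrit : ∀ i, eval (v i) f.jacobian ≠ 0)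
    (hdist : ∀ i j, i ≠ j → eval (f.lift (v j)) (lin (f.lift (v i))) ≠ 0) :
    eval (rootForm v) F.jacobian ≠ 0 := by
  intro hJ
  obtain ⟨u, hu, huF⟩ := (F.eval_jacobian_eq_zero_iff _).1 hJ
  -- A kernel vector `u`, read as a binary form, vanishes at each root `v i`: the derivative of the
  -- norm over `f(v i)` is, up to sign, `u(v i)` times `∏ h(v j)`. That product is nonzero because
  -- `v i` is noncritical and the other roots have other images.
  have hroot : ∀ i, eval u (evForm n (v i)) = 0 := by
    intro i
    have hy := f.lift_ne_zero (hv i)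
    obtain ⟨h, hh⟩ := exists_fiberForm_eq f (hv i)
    obtain ⟨h0, m, hm⟩ := exists_isHomogeneous_of_fiberForm_dvd hd f hy (Dvd.intro_left _ hh.symm)
    obtain ⟨T, -, hT⟩ := exists_isNorm hm h0 n
    have hnorm : IsNorm n (fiberForm f (f.lift (v i))) _ := hh ▸ (isNorm_lin (v i)).mul hT
    have hsum : dirDeriv (∑ j : Fin (n + 1), C (f.lift (v i) 0 ^ (j : ℕ) *
        f.lift (v i) 1 ^ (n - (j : ℕ))) * F.form j) (rootForm v) u = 0 := by
      rw [dirDeriv_sum]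
      exact Finset.sum_eq_zero fun j _ => by rw [dirDeriv_C_mul, huF, mul_zero]
    have hw : eval (rootForm v) (evForm n (v i)) = 0 := by
      rw [eval_rootForm_evForm]
      exact Finset.prod_eq_zero (Finset.mem_univ i) (eval_lin_self _)
    rw [hF.sum_eq_norm hn hnorm, dirDeriv_mul, dirDeriv_C_mul, dirDeriv_evForm, map_mul, hw,
      mul_zero, zero_mul, add_zero, hT v] at hsum
    have hprod : ∏ j, eval (v j) h ≠ 0 := by
      refine Finset.prod_ne_zero_iff.2 fun j _ hz => ?_
      by_cases hij : i = j
      · subst hij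
        apply hcrit i
        rw [f.eval_jacobian_of_fiberForm_eq (hv i) hh, hz, mul_zero, neg_zero]
      · apply hdist i j hij
        rw [eval_lin_swap, ← eval_fiberForm, hh, map_mul, hz, mul_zero, neg_zero]
    have h1 := (mul_eq_zero.1 hsum).resolve_right hprod
    exact (mul_eq_zero.1 h1).resolve_left (pow_ne_zero _ (neg_ne_zero.2 one_ne_zero))
  have hdist' : ∀ i j, i ≠ j → eval (v j) (lin (v i)) ≠ 0 := by
    intro i j hij hz
    obtain ⟨s, hs⟩ := exists_eq_smul_of_eval_lin_eq_zero (hv i) hz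
    apply hdist i j hij
    rw [hs, ProjEnd.lift_smul, eval_smul_of_isHomogeneous (lin_isHomogeneous _), eval_lin_self,
      mul_zero]
  -- So `u` is a multiple of the base point itself, where Euler's identity prevents the derivative
  -- from vanishing.
  obtain ⟨s, rfl⟩ := exists_eq_smul_rootForm hn hv hdist' hroot
  have hs : s ≠ 0 := fun h => hu (by rw [h, zero_smul])
  refine rootForm_ne_zero hv (F.eq_zero_of_forall_eval _ fun i => ?_)
  have := huF i
  rw [dirDeriv_smul_right, dirDeriv_self (F.homogeneous i)] at this
  simpa [hs, (natCast_ne_zero_of_one_le hd : (d : k) ≠ 0)] using this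

/-- On the line `y = 1`, Euler's identity turns the Jacobian into the Wronskian up to the factor
`d`. Coprime polynomials with zero Wronskian have zero derivatives in characteristic zero, so both
coordinates would be constant there and vanish together at infinity. -/
theorem ProjEnd.jacobian_ne_zero_of_line [CharZero k] (hd : 1 ≤ d) (f : ProjEnd k 1 d) :
    f.jacobian ≠ 0 := by
  intro hJ
  have hcop : IsCoprime (dehomogenize (f.form 0)) (dehomogenize (f.form 1)) := by
    rw [Polynomial.isCoprime_iff_aeval_ne_zero_of_isAlgClosed k k]
    intro t
    by_contra! hcon
    simp only [Polynomial.coe_aeval_eq_eval, eval_dehomogenize] at hcon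
    have := f.eq_zero_of_forall_eval ![t, 1] fun i => by
      fin_cases i
      · exact hcon.1
      · exact hcon.2
    simpa using congrFun this 1
  have hw : Polynomial.wronskian (dehomogenize (f.form 0)) (dehomogenize (f.form 1)) = 0 := by
    refine Polynomial.funext fun t => ?_
    have e0 := dirDeriv_self (f.homogeneous 0) ![t, 1]
    have e1 := dirDeriv_self (f.homogeneous 1) ![t, 1]
    have hJt : eval ![t, 1] f.jacobian = 0 := by rw [hJ, map_zero]
    rw [eval_jacobian, Matrix.det_fin_two] at hJt
    simp only [dirDeriv_eq_add, Matrix.cons_val_zero, Matrix.cons_val_one, mul_one,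
      Matrix.of_apply] at e0 e1 hJt
    simp only [Polynomial.wronskian, derivative_dehomogenize, Polynomial.eval_sub,
      Polynomial.eval_mul, eval_dehomogenize, Polynomial.eval_zero]
    apply mul_left_cancel₀ (natCast_ne_zero_of_one_le hd : (d : k) ≠ 0)
    linear_combination eval ![t, 1] (pderiv 0 (f.form 0)) * e1 -
      eval ![t, 1] (pderiv 0 (f.form 1)) * e0 - hJt
  obtain ⟨h0, h1⟩ := hcop.wronskian_eq_zero_iff.1 hw
  have key : ∀ i, Polynomial.derivative (dehomogenize (f.form i)) = 0 →
      eval ![1, 0] (f.form i) = 0 := fun i hi =>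
    eval_infinity_eq_zero (f.homogeneous i) (by omega)
      (e := (dehomogenize (f.form i)).coeff 0) fun t => by
        rw [← eval_dehomogenize, Polynomial.eq_C_of_derivative_eq_zero hi]
        simp
  have := f.eq_zero_of_forall_eval ![1, 0] fun i => by
    fin_cases i
    · exact key 0 h0
    · exact key 1 h1
  simpa using congrFun this 0

end CriticalPoints

/-! ### Iteration and the two implications. -/

section Dynamics

variable {k : Type*} [Field k] {n d : ℕ}

theorem IsSymmetricPower.iterate_map_vieta {f : ProjEnd k 1 d} {F : ProjEnd k n d}
    (hF : IsSymmetricPower f F) (i : ℕ) (P : Fin n → PSpace k 1) :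
    F.map^[i] (vieta P) = vieta fun j => f.map^[i] (P j) := by
  induction i with
  | zero => rfl
  | succ i ih =>
    simp only [Function.iterate_succ_apply']
    rw [ih, hF]

theorem lin_rep_eq_zero_iff {P Q : PSpace k 1} : eval Q.rep (lin P.rep) = 0 ↔ P = Q := by
  rw [eval_lin_eq_zero_iff_mk_eq P.rep_nonzero Q.rep_nonzero, Q.mk_rep, P.mk_rep, eq_comm]

theorem vieta_mem_zeroLocus_evForm {P : Fin n → PSpace k 1} {c : PSpace k 1} :
    vieta P ∈ zeroLocus {evForm n c.rep} ↔ ∃ l, P l = c := by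
  have h : vieta P = Projectivization.mk k (rootForm fun i => (P i).rep)
      (rootForm_ne_zero fun i => (P i).rep_nonzero) := rfl
  rw [h, mk_mem_zeroLocus_singleton (evForm_isHomogeneous _), eval_rootForm_evForm,
    Finset.prod_eq_zero_iff]
  simp [lin_rep_eq_zero_iff]

theorem zeroLocus_lin_rep (c : PSpace k 1) : zeroLocus {lin c.rep} = {c} := by
  ext P
  rw [mem_zeroLocus_singleton, lin_rep_eq_zero_iff, Set.mem_singleton_iff, eq_comm]

theorem finite_range_iterate {α : Type*} (g : α → α) (x : α) {s t : ℕ} (hst : s < t)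
    (h : g^[s] x = g^[t] x) : (Set.range fun i => g^[i] x).Finite := by
  refine ((Set.finite_lt_nat t).image fun i => g^[i] x).subset ?_
  rintro _ ⟨i, rfl⟩
  induction i using Nat.strong_induction_on with
  | _ i ih =>
    by_cases hi : i < t
    · exact ⟨i, hi, rfl⟩
    · have : g^[i] x = g^[i - t + s] x := by
        rw [Function.iterate_add_apply, h, ← Function.iterate_add_apply]
        congr 2
        omega
      simp only [this]
      exact ih _ (by omega)

instance [Infinite k] : Infinite (PSpace k 1) := by
  have hne : ∀ t : k, (![t, 1] : Fin 2 → k) ≠ 0 := fun t h => by simpa using congrFun h 1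
  refine Infinite.of_injective (fun t : k => Projectivization.mk k ![t, 1] (hne t)) fun s t h => ?_
  rw [← eval_lin_eq_zero_iff_mk_eq] at h
  simpa [eval_lin, sub_eq_zero] using h

variable [IsAlgClosed k]

theorem ProjEnd.map_surjective_of_line (hd : 1 ≤ d) (f : ProjEnd k 1 d) :
    Function.Surjective f.map := by
  intro P
  obtain ⟨x, hx, hx0⟩ :=
    exists_eval_eq_zero_of_isHomogeneous (fiberForm_isHomogeneous f P.rep) (by omega)
  rw [eval_fiberForm, eval_lin_eq_zero_iff_mk_eq (f.lift_ne_zero hx) P.rep_nonzero,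
    P.mk_rep] at hx0
  exact ⟨Projectivization.mk k x hx, by rw [f.map_mk, hx0]⟩

variable [CharZero k]

theorem ProjEnd.criticalLocus_finite_of_line (hd : 1 ≤ d) (f : ProjEnd k 1 d) :
    f.criticalLocus.Finite := by
  obtain ⟨e, he, v, hv, h⟩ :=
    exists_eq_C_mul_prod_lin f.jacobian_isHomogeneous (f.jacobian_ne_zero_of_line hd)
  refine (Set.finite_range fun i => Projectivization.mk k (v i) (hv i)).subset fun P hP => ?_
  rw [criticalLocus, mem_zeroLocus_singleton, h, map_mul, eval_C, mul_eq_zero, map_prod,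
    Finset.prod_eq_zero_iff] at hP
  obtain ⟨i, -, hi⟩ := hP.resolve_left he
  rw [eval_lin_eq_zero_iff_mk_eq (hv i) P.rep_nonzero, P.mk_rep] at hi
  exact ⟨i, hi.symm⟩

theorem ProjEnd.isIrredComponent_criticalLocus_iff_of_line (hd : 1 ≤ d) (f : ProjEnd k 1 d)
    (Z : Set (PSpace k 1)) :
    IsIrredComponent Z f.criticalLocus ↔ ∃ c ∈ f.criticalLocus, Z = {c} := by
  have hJ := f.jacobian_isHomogeneous
  have hJ0 := f.jacobian_ne_zero_of_line hd
  rw [criticalLocus, isIrredComponent_zeroLocus_singleton_iff le_rfl hJ hJ0]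
  constructor
  · rintro ⟨g, hg, hgJ, rfl⟩
    obtain ⟨m, hm⟩ := exists_isHomogeneous_of_dvd hJ hJ0 hgJ
    obtain ⟨c, hc⟩ := zeroLocus_singleton_nonempty le_rfl hm (degree_ne_zero_of_irreducible hg hm)
    refine ⟨c, zeroLocus_mono_of_dvd hgJ hc, ?_⟩
    have hd := lin_dvd hm c.rep_nonzero (mem_zeroLocus_singleton.1 hc)
    have ha := (lin_irreducible c.rep_nonzero).associated_of_dvd hg hd
    rw [← zeroLocus_lin_rep c]
    exact (zeroLocus_mono_of_dvd ha.symm.dvd).antisymm (zeroLocus_mono_of_dvd ha.dvd)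
  · rintro ⟨c, hc, rfl⟩
    exact ⟨lin c.rep, lin_irreducible c.rep_nonzero,
      lin_dvd hJ c.rep_nonzero (mem_zeroLocus_singleton.1 hc), (zeroLocus_lin_rep c).symm⟩

theorem ProjEnd.postCriticallyFinite_iff_of_line (hd : 1 ≤ d) (f : ProjEnd k 1 d) :
    f.PostCriticallyFinite ↔
      ∀ c ∈ f.criticalLocus, ∃ s t : ℕ, s ≠ t ∧ f.map^[s] c = f.map^[t] c := by
  simp only [PostCriticallyFinite, IsPreperiodic, f.isIrredComponent_criticalLocus_iff_of_line hd]
  constructor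
  · intro h c hc
    obtain ⟨s, t, hst, h⟩ := h _ ⟨c, hc, rfl⟩
    exact ⟨s, t, hst, by simpa using h⟩
  · rintro h _ ⟨c, hc, rfl⟩
    obtain ⟨s, t, hst, h⟩ := h c hc
    exact ⟨s, t, hst, by simp [h]⟩

theorem IsSymmetricLift.vieta_notMem_criticalLocus (hn : 1 ≤ n) (hd : 1 ≤ d) {f : ProjEnd k 1 d}
    {F : ProjEnd k n d} (hF : IsSymmetricLift f F) {P : Fin n → PSpace k 1}
    (hP : ∀ i, P i ∉ f.criticalLocus) (hinj : Function.Injective fun i => f.map (P i)) :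
    vieta P ∉ F.criticalLocus := by
  have h : vieta P = Projectivization.mk k (rootForm fun i => (P i).rep)
      (rootForm_ne_zero fun i => (P i).rep_nonzero) := rfl
  rw [h, ProjEnd.mk_mem_criticalLocus]
  refine hF.eval_jacobian_ne_zero hn hd (fun i => (P i).rep_nonzero)
    (fun i hi => hP i (mem_zeroLocus_singleton.2 hi)) fun i j hij hz => hij ?_
  rw [eval_lin_eq_zero_iff_mk_eq (f.lift_ne_zero (P i).rep_nonzero)
    (f.lift_ne_zero (P j).rep_nonzero)] at hz
  exact hinj hz.symm

/-- A noncritical point exists: take preimages of `n` distinct points outside the finite set of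
critical values of `f`. -/
theorem IsSymmetricLift.jacobian_ne_zero (hn : 1 ≤ n) (hd : 1 ≤ d) {f : ProjEnd k 1 d}
    {F : ProjEnd k n d} (hF : IsSymmetricLift f F) : F.jacobian ≠ 0 := by
  intro hJ
  have hfin : (f.map '' f.criticalLocus).Finite := (f.criticalLocus_finite_of_line hd).image _
  let e := hfin.infinite_compl.natEmbedding
  choose Q hQ using fun i : Fin n => f.map_surjective_of_line hd (e i)
  refine hF.vieta_notMem_criticalLocus hn hd (P := Q) (fun i hi => ?_) (fun i j hij => ?_) ?_
  · exact (e i).2 ⟨Q i, hi, hQ i⟩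
  · simp only [hQ] at hij
    exact Fin.ext (e.injective (Subtype.ext hij))
  · rw [ProjEnd.criticalLocus, mem_zeroLocus_singleton, hJ, map_zero]

theorem IsSymmetricLift.isIrredComponent_zeroLocus_evForm (hn : 1 ≤ n) (hd : 1 ≤ d)
    {f : ProjEnd k 1 d} {F : ProjEnd k n d} (hF : IsSymmetricLift f F) {c : PSpace k 1}
    (hc : c ∈ f.criticalLocus) :
    IsIrredComponent (zeroLocus {evForm n c.rep}) F.criticalLocus := by
  have hirr := irreducible_of_isHomogeneous_one (evForm_isHomogeneous (n := n) c.rep)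
    (evForm_ne_zero c.rep_nonzero)
  rw [ProjEnd.criticalLocus, isIrredComponent_zeroLocus_singleton_iff hn F.jacobian_isHomogeneous
    (hF.jacobian_ne_zero hn hd)]
  refine ⟨_, hirr, ?_, rfl⟩
  refine dvd_of_zeroLocus_subset hn hirr (evForm_isHomogeneous _) F.jacobian_isHomogeneous
    fun P hP => ?_
  exact hF.eval_jacobian_eq_zero hn hd c.rep_nonzero (mem_zeroLocus_singleton.1 hc)
    (mem_zeroLocus_singleton.1 hP)

theorem IsSymmetricPower.postCriticallyFinite (hn : 1 ≤ n) (hd : 1 ≤ d) {f : ProjEnd k 1 d}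
    {F : ProjEnd k n d} (hF : IsSymmetricPower f F) (hF' : F.PostCriticallyImproper) :
    f.PostCriticallyFinite := by
  rw [f.postCriticallyFinite_iff_of_line hd]
  intro c hc
  obtain ⟨G, hG⟩ := exists_isSymmetricLift hn hd f
  have hcomp := hG.isIrredComponent_zeroLocus_evForm hn hd hc
  rw [ProjEnd.criticalLocus_eq_of_map_eq hd (hG.isSymmetricPower.map_eq hn hF)] at hcomp
  obtain ⟨i, hi, R, hR⟩ := hF' _ hcomp
  obtain ⟨P, rfl⟩ := vieta_surjective hn R
  have key : ∀ j, ∃ l, P l = f.map^[i j] c := by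
    intro j
    obtain ⟨R, hRc, hRP⟩ := Set.mem_iInter.1 hR j
    obtain ⟨P', rfl⟩ := vieta_surjective hn R
    obtain ⟨l, hl⟩ := vieta_mem_zeroLocus_evForm.1 hRc
    rw [← vieta_mem_zeroLocus_evForm, ← hRP, hF.iterate_map_vieta, vieta_mem_zeroLocus_evForm]
    exact ⟨l, by rw [hl]⟩
  choose l hl using key
  -- The `n + 1` iterates of `c` all occur among the `n` roots.
  obtain ⟨a, b, hab, hlab⟩ := Fintype.exists_ne_map_eq_of_card_lt l (by simp)
  exact ⟨i a, i b, fun h => hab (hi.injective h), by rw [← hl, ← hl, hlab]⟩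

theorem ProjEnd.exists_finite_postcritical_set (hd : 1 ≤ d) {f : ProjEnd k 1 d}
    (hf : f.PostCriticallyFinite) :
    ∃ S : Set (PSpace k 1), S.Finite ∧ ∀ c ∈ f.criticalLocus, ∀ i, f.map^[i] c ∈ S := by
  rw [f.postCriticallyFinite_iff_of_line hd] at hf
  refine ⟨⋃ c ∈ f.criticalLocus, Set.range fun i => f.map^[i] c,
    (f.criticalLocus_finite_of_line hd).biUnion fun c hc => ?_,
    fun c hc i => Set.mem_biUnion hc ⟨i, rfl⟩⟩
  obtain ⟨s, t, hst, h⟩ := hf c hc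
  rcases lt_or_gt_of_ne hst with hst | hst
  · exact finite_range_iterate _ _ hst h
  · exact finite_range_iterate _ _ hst h.symm

theorem IsSymmetricPower.postCriticallyImproper (hn : 1 ≤ n) (hd : 1 ≤ d) {f : ProjEnd k 1 d}
    {F : ProjEnd k n d} (hF : IsSymmetricPower f F) (hf : f.PostCriticallyFinite) :
    F.PostCriticallyImproper := by
  intro Z hZ
  have hZF := hZ.1.2
  obtain ⟨G, hG⟩ := exists_isSymmetricLift hn hd f
  rw [ProjEnd.criticalLocus_eq_of_map_eq hd (hF.map_eq hn hG.isSymmetricPower)] at hZ hZF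
  have hJ0 := hG.jacobian_ne_zero hn hd
  obtain ⟨g, hg, hgJ, rfl⟩ :=
    (isIrredComponent_zeroLocus_singleton_iff hn G.jacobian_isHomogeneous hJ0 Z).1 hZ
  obtain ⟨m, hm⟩ := exists_isHomogeneous_of_dvd G.jacobian_isHomogeneous hJ0 hgJ
  obtain ⟨S, hS, hSf⟩ := ProjEnd.exists_finite_postcritical_set hd hf
  obtain ⟨r, rfl⟩ : ∃ r, n = r + 1 := ⟨n - 1, by omega⟩
  let e := hS.infinite_compl.natEmbedding
  -- These prescribed roots do not depend on `i`; only the remaining root of the point found in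
  -- `F^{i+1}(Z)` varies.
  let p : Fin r → PSpace k 1 := fun j => e j
  have hp : Function.Injective p := fun i j hij => Fin.ext (e.injective (Subtype.ext hij))
  have hpS : ∀ j, p j ∉ S := fun j => (e j).2
  -- The exponent is `i + 1` because a coincidence of roots on the critical locus is seen only after
  -- one application of `f`.
  have key : ∀ i : ℕ, ∃ q : ↥(S ∪ Set.range p),
      vieta (Fin.cons q.1 p : Fin (r + 1) → PSpace k 1) ∈ F.map^[i + 1] '' zeroLocus {g} := by
    intro i
    choose Q hQ using fun j => (f.map_surjective_of_line hd).iterate (i + 1) (p j)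
    obtain ⟨x, hx, hx0⟩ := exists_eval_rootForm_cons_eq_zero hm
      (degree_ne_zero_of_irreducible hg hm) fun j => (Q j).rep
    set P : PSpace k 1 := Projectivization.mk k x hx with hP
    have hv : ∀ j, (Fin.cons x fun j => (Q j).rep : Fin (r + 1) → Fin 2 → k) j ≠ 0 := fun j => by
      induction j using Fin.cases with
      | zero => simpa using hx
      | succ j => simpa using (Q j).rep_nonzero
    have hmem : vieta (Fin.cons P Q : Fin (r + 1) → PSpace k 1) ∈ zeroLocus {g} := by
      rw [← mk_mem_zeroLocus_singleton hm (rootForm_ne_zero hv), ← vieta_mk hv] at hx0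
      convert hx0 using 2
      funext j
      induction j using Fin.cases with
      | zero => simp [hP]
      | succ j => simp [Projectivization.mk_rep]
    -- The roots `Q j` are noncritical because `p j ∉ S`, and their images are distinct because the
    -- `p j` are. So either `P` is critical, with its orbit in `S`, or `f(P) = f(Q j)` for some `j`.
    have hPS : f.map^[i + 1] P ∈ S ∪ Set.range p := by
      by_contra hcon
      rw [Set.mem_union, not_or] at hcon
      refine hG.vieta_notMem_criticalLocus hn hd (P := Fin.cons P Q) (fun j => ?_) ?_ (hZF hmem)
      · induction j using Fin.cases with
        | zero => exact fun hc => hcon.1 (hSf _ hc _)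
        | succ j => exact fun hc => hpS j (hQ j ▸ hSf _ hc _)
      · have hne : ∀ j, f.map P ≠ f.map (Q j) := fun j hj => hcon.2 ⟨j, by
          rw [← hQ j, Function.iterate_succ_apply, Function.iterate_succ_apply, hj]⟩
        intro a b hab
        induction a using Fin.cases with
        | zero =>
          induction b using Fin.cases with
          | zero => rfl
          | succ b => exact absurd hab (hne b)
        | succ a =>
          induction b using Fin.cases with
          | zero => exact absurd hab.symm (hne a)
          | succ b =>
            have hab' : f.map (Q a) = f.map (Q b) := hab
            rw [hp (a₁ := a) (a₂ := b) (by
              rw [← hQ a, ← hQ b, Function.iterate_succ_apply, Function.iterate_succ_apply, hab'])]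
    refine ⟨⟨_, hPS⟩, _, hmem, ?_⟩
    rw [hF.iterate_map_vieta]
    congr 1
    funext j
    induction j using Fin.cases with
    | zero => rfl
    | succ j => exact hQ j
  choose q hq using key
  have : Finite ↥(S ∪ Set.range p) := (hS.union (Set.finite_range p)).to_subtype
  -- One value `q₀` occurs for infinitely many `i`; enumerating these indices gives the required
  -- increasing exponents.
  obtain ⟨q₀, hq₀⟩ := Finite.exists_infinite_fiber q
  have hinf : {i | q i = q₀}.Infinite := Set.infinite_coe_iff.1 hq₀
  let s := Nat.nth fun i => q i = q₀
  have hs : ∀ j, q (s j) = q₀ := Nat.nth_mem_of_infinite hinf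
  refine ⟨fun j => s j + 1, fun a b hab => ?_, vieta (Fin.cons q₀.1 p), ?_⟩
  · exact Nat.add_lt_add_right (Nat.nth_strictMono hinf hab) 1
  · refine Set.mem_iInter.2 fun j => ?_
    rw [← hs j]
    exact hq (s j)

end Dynamics

end DynImproper

theorem mainTheorem10 {k : Type*} [Field k] [IsAlgClosed k] [CharZero k]
    (n d : ℕ) (hn : 1 ≤ n) (hd : 1 ≤ d) (f : DynImproper.ProjEnd k 1 d) :
    (∃ F : DynImproper.ProjEnd k n d, DynImproper.IsSymmetricPower f F) ∧
    ∀ F : DynImproper.ProjEnd k n d, DynImproper.IsSymmetricPower f F →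
      (F.PostCriticallyImproper ↔ f.PostCriticallyFinite) := by
  obtain ⟨F, hF⟩ := DynImproper.exists_isSymmetricLift hn hd f
  exact ⟨⟨F, hF.isSymmetricPower⟩, fun F hF =>
    ⟨hF.postCriticallyFinite hn hd, hF.postCriticallyImproper hn hd⟩⟩
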